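/- Let $H\in(\tfrac12,1)$, $\sigma>0$, and let $a:[0,1]\to\mathbb R$ be continuous. Put $$c_H=\sqrt{\frac{2H\,\Gamma(\frac32-H)}{\Gamma(H+\frac12)\,\Gamma(2-2H)}},\qquad k_H(t,s)=c_H\left(H-\tfrac12\right)s^{\frac12-H}\int_s^t u^{H-\frac12}(u-s)^{H-\frac32}\,du .$$ For integers $1\le i<n\le N$ (in the definitions of $g_n^{(N,H)}$ and $a_n^{(N)}$: $1\le n\le N$) let $$J_n^{(N,H)}(i)=\sigma\sqrt N\int_{\frac{i-1}N}^{\frac iN}\left(k_H\left(\tfrac nN,u\right)-k_H\left(\tfrac{n-1}N,u\right)\right)du,\quad g_n^{(N,H)}=\sigma\sqrt N\int_{\frac{n-1}N}^{\frac nN}k_H\left(\tfrac nN,u\right)du,\quad a_n^{(N)}=\tfrac1N\,a\left(\tfrac nN\right).$$ The set of arbitrage points at level $n\in\{1,\dots,N\}$ of the $N$-period fractional binary market is the set $\mathcal A_n^{(N,H)}$ of all $x\in\{-1,1\}^{n-1}$ for which the condition $$Y_n^{(N,H)}(x)-g_n^{(N,H)}<-a_n^{(N)}<Y_n^{(N,H)}(x)+g_n^{(N,H)},\qquad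 Y_n^{(N,H)}(x)=\sum_{i=1}^{n-1}J_n^{(N,H)}(i)\,x_i,$$ fails (for $n=1$, $\{-1,1\}^0$ consists of the root only and $Y_1^{(N,H)}=0$), and $\mathcal A^{(N,H)}=\bigcup_{n=1}^N\mathcal A_n^{(N,H)}$ is the set of all arbitrage points; it is a subset of the binary tree $\bigcup_{n=1}^{N}\{-1,1\}^{n-1}$, which has $2^N-1$ points. Let $(\xi_k)_{k\ge1}$ be independent random variables on a probability space with $P(\xi_k=1)=P(\xi_k=-1)=\tfrac12$, and let $$g_H=\frac{\sigma c_H}{H+\frac12},\qquad h=\frac H2+\frac14,\qquad \rho_h(k)=\tfrac12\left((k+1)^{2h}+(k-1)^{2h}-2k^{2h}\right),\qquad \mathcal Y_H=2g_H\sum_{k=1}^\infty\rho_h(k)\,\xi_k .$$ Then the series defining $\mathcal Y_H$ converges almost surely, and for every sequence of integers $N_n\ge n$, $$\lim_{n\to\infty}\frac{|\mathcal A_n^{(N_n,H)}|}{2^{n-1}}=P(|\mathcal Y_H|>g_H)>0 .$$ Moreover, $$\lim_{N\to\infty}\frac{|\mathcal A^{(N,H)}|}{2^N-1}=P(|\mathcal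 Y_H|>g_H).$$ -/

import Mathlib

open MeasureTheory ProbabilityTheory Filter Topology

namespace FractionalBinary

noncomputable section

/-- The normalizing constant `c_H`. -/
def cH (H : ℝ) : ℝ :=
  Real.sqrt (2 * H * Real.Gamma (3 / 2 - H) / (Real.Gamma (H + 1 / 2) * Real.Gamma (2 - 2 * H)))

/-- The Volterra kernel `k_H(t, s)` of fractional Brownian motion with Hurst parameter `H`. -/
def kernel (H t s : ℝ) : ℝ :=
  cH H * (H - 1 / 2) * s ^ (1 / 2 - H) *
    ∫ u in s..t, u ^ (H - 1 / 2) * (u - s) ^ (H - 3 / 2)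

/-- The weight `J_n^{(N,H)}(i)`, for `1 ≤ i < n ≤ N`, of the `i`-th past coin at time `n`. -/
def J (σ H : ℝ) (N n i : ℕ) : ℝ :=
  σ * Real.sqrt N *
    ∫ u in (((i : ℝ) - 1) / N)..((i : ℝ) / N),
      (kernel H ((n : ℝ) / N) u - kernel H (((n : ℝ) - 1) / N) u)

/-- The weight `g_n^{(N,H)}`, for `1 ≤ n ≤ N`, of the present coin at time `n`. -/
def g (σ H : ℝ) (N n : ℕ) : ℝ :=
  σ * Real.sqrt N *
    ∫ u in (((n : ℝ) - 1) / N)..((n : ℝ) / N), kernel H ((n : ℝ) / N) u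

/-- The discretized drift `a_n^{(N)} = a(n / N) / N`. -/
def drift (a : ℝ → ℝ) (N n : ℕ) : ℝ := 1 / (N : ℝ) * a ((n : ℝ) / N)

/-- The points `{-1, 1}^{n-1}` of the binary tree at level `n ≥ 1`; the set `{-1, 1}` is the group
of units of `ℤ`. Level `1` consists of the root only. -/
abbrev Level (n : ℕ) : Type := Fin (n - 1) → ℤˣ

/-- `Y_n^{(N,H)}(x_1, …, x_{n-1}) = ∑_{i=1}^{n-1} J_n^{(N,H)}(i) x_i`; the coordinate `x_{i+1}` is
stored at the index `i < n - 1`. -/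
def Y (σ H : ℝ) (N n : ℕ) (x : Level n) : ℝ :=
  ∑ i : Fin (n - 1), J σ H N n ((i : ℕ) + 1) * (((x i : ℤˣ) : ℤ) : ℝ)

/-- The value `u_n^{(N)}(x)` of `X_n^{(N,H)}` after an up move. -/
def up (σ H : ℝ) (N n : ℕ) (x : Level n) : ℝ := Y σ H N n x + g σ H N n

/-- The value `d_n^{(N)}(x)` of `X_n^{(N,H)}` after a down move. -/
def down (σ H : ℝ) (N n : ℕ) (x : Level n) : ℝ := Y σ H N n x - g σ H N n

/-- The set of arbitrage points at level `n` of the `N`-period fractional binary market: the points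
where the no-arbitrage condition `d_n(x) < -a_n < u_n(x)` fails. -/
def arbitrageLevel (σ H : ℝ) (a : ℝ → ℝ) (N n : ℕ) : Set (Level n) :=
  {x | up σ H N n x ≤ -drift a N n ∨ -drift a N n ≤ down σ H N n x}

/-- The `N`-binary tree: the disjoint union of its levels `1, …, N`. -/
abbrev Tree (N : ℕ) : Type := Σ n : Finset.Icc 1 N, Level (n : ℕ)

/-- The set of all arbitrage points of the `N`-period fractional binary market. -/
def arbitragePoints (σ H : ℝ) (a : ℝ → ℝ) (N : ℕ) : Set (Tree N) :=
  ⋃ n : Finset.Icc 1 N, Sigma.mk n '' arbitrageLevel σ H a N (n : ℕ)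

/-- The constant `g_H = σ c_H / (H + 1/2)`. -/
def gLim (σ H : ℝ) : ℝ := σ * cH H / (H + 1 / 2)

/-- The autocovariance function `ρ_h(k)`, `k ≥ 1`, of fractional Gaussian noise with Hurst
parameter `h`. -/
def rho (h : ℝ) (k : ℕ) : ℝ :=
  1 / 2 * (((k : ℝ) + 1) ^ (2 * h) + ((k : ℝ) - 1) ^ (2 * h) - 2 * (k : ℝ) ^ (2 * h))

/-- The partial sum `2 g_H ∑_{k=1}^m ρ_h(k) ξ_k` with `h = H / 2 + 1 / 4`; the coin `ξ_{k+1}` is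
`ξ k`. -/
def limitPartialSum {Ω : Type*} (σ H : ℝ) (ξ : ℕ → Ω → ℝ) (m : ℕ) (ω : Ω) : ℝ :=
  2 * gLim σ H * ∑ k ∈ Finset.range m, rho (H / 2 + 1 / 4) (k + 1) * ξ k ω

/-- The random variable `𝒴_H = 2 g_H ∑_{k ≥ 1} ρ_h(k) ξ_k`. The series does not converge absolutely,
so it is the pointwise limit of the partial sums (with an arbitrary value where there is none). -/
def limitVar {Ω : Type*} (σ H : ℝ) (ξ : ℕ → Ω → ℝ) (ω : Ω) : ℝ :=
  limUnder atTop (fun m => limitPartialSum σ H ξ m ω)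

end

end FractionalBinary

open MeasureTheory ProbabilityTheory Filter Topology

namespace FractionalBinary

noncomputable section

/-! The kernel is homogeneous, so after multiplication by `N ^ H` the weights of the coins no longer
depend on `N` (`J_eq`, `g_eq`), while the drift becomes `N ^ (H - 1)` times a bounded quantity and
disappears. A point of level `n` is then an arbitrage point exactly when a weighted sum of its
signs, plus a vanishing shift, is at least the present weight in absolute value
(`mem_arbitrageLevel_iff`).

Far from time `0` the factor `u ^ (H - 1/2) * s ^ (1/2 - H)` is close to `1`, and the kernel behaves
like `cH H * (t - s) ^ (H - 1/2)`. Read backwards from the present, the past weights therefore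
converge to second differences of `x ^ (H + 1/2)`, that is, to multiples of `rho`. The convergence
even holds in `ℓ²` (`tendsto_sum_pastWeight_sub_limitWeight_sq`). By orthogonality of the coins, the
random sum at level `n` differs from the partial sum of the limit series by an error tending to `0`
in `L²`.

The coefficients of the limit series are positive and square summable, but not summable. Square
summability gives almost sure convergence by martingales. Positivity excludes atoms
(`measure_series_eq`), so the probabilities of exceeding the threshold converge
(`tendsto_measure_le_abs_sum_add`). Divergence of the sum makes every level exceeded with positive
probability (`measure_lt_series_pos`).

For the whole tree, level `i + 1` has weight `2 ^ i`, so the last levels dominate. The freedom in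
the choice of the sequence of horizons makes the convergence by levels uniform in the horizon. -/

/-! ### Two-sided bounds and integrability of the kernel. -/

lemma cH_pos {H : ℝ} (hH : 1 / 2 < H) (hH' : H < 1) : 0 < cH H := by
  refine Real.sqrt_pos.2 (div_pos (mul_pos (by linarith) (Real.Gamma_pos_of_pos (by linarith)))
    (mul_pos (Real.Gamma_pos_of_pos (by linarith)) (Real.Gamma_pos_of_pos (by linarith))))

lemma intervalIntegrable_sub_rpow {H : ℝ} (hH : 1 / 2 < H) (s p q : ℝ) :
    IntervalIntegrable (fun u => (u - s) ^ (H - 3 / 2)) volume p q := by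
  simpa using (intervalIntegral.intervalIntegrable_rpow' (a := p - s) (b := q - s)
    (r := H - 3 / 2) (by linarith)).comp_sub_right s

lemma intervalIntegrable_kernel_integrand {H : ℝ} (hH : 1 / 2 < H) (s p q : ℝ) :
    IntervalIntegrable (fun u => u ^ (H - 1 / 2) * (u - s) ^ (H - 3 / 2)) volume p q := by
  refine (intervalIntegrable_sub_rpow hH s p q).continuousOn_mul ?_
  exact (Real.continuous_rpow_const (by linarith)).continuousOn

lemma integral_sub_rpow {H : ℝ} (hH : 1 / 2 < H) (s p q : ℝ) :
    ∫ u in p..q, (u - s) ^ (H - 3 / 2) =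
      ((q - s) ^ (H - 1 / 2) - (p - s) ^ (H - 1 / 2)) / (H - 1 / 2) := by
  rw [intervalIntegral.integral_comp_sub_right (fun x => x ^ (H - 3 / 2)) s,
    integral_rpow (Or.inl (by linarith))]
  have : H - 3 / 2 + 1 = H - 1 / 2 := by ring
  rw [this]

lemma kernel_sub_kernel {H : ℝ} (hH : 1 / 2 < H) (p q s : ℝ) :
    kernel H q s - kernel H p s = cH H * (H - 1 / 2) * s ^ (1 / 2 - H) *
      ∫ u in p..q, u ^ (H - 1 / 2) * (u - s) ^ (H - 3 / 2) := by
  have h := intervalIntegral.integral_interval_sub_left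
    (intervalIntegrable_kernel_integrand hH s s q) (intervalIntegrable_kernel_integrand hH s s p)
  rw [← h]
  simp only [kernel]
  ring

lemma kernel_self (H s : ℝ) : kernel H s s = 0 := by simp [kernel]

/-- On `[p, q]` the factor `u ^ (H - 1/2)` lies between `s ^ (H - 1/2)` and `q ^ (H - 1/2)`, and the
remaining integral is explicit. The lower bound cancels `s ^ (1/2 - H)`; the upper bound in
`kernel_sub_kernel_le` is larger by the factor `(q / s) ^ (H - 1/2)`. -/
lemma le_kernel_sub_kernel {H : ℝ} (hH : 1 / 2 < H) (hH' : H < 1) {s p q : ℝ} (hs : 0 < s)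
    (hsp : s ≤ p) (hpq : p ≤ q) :
    cH H * ((q - s) ^ (H - 1 / 2) - (p - s) ^ (H - 1 / 2)) ≤ kernel H q s - kernel H p s := by
  have hc := cH_pos hH hH'
  have hα : 0 < H - 1 / 2 := by linarith
  have key : s ^ (H - 1 / 2) * (((q - s) ^ (H - 1 / 2) - (p - s) ^ (H - 1 / 2)) / (H - 1 / 2)) ≤
      ∫ u in p..q, u ^ (H - 1 / 2) * (u - s) ^ (H - 3 / 2) := by
    rw [← integral_sub_rpow hH, ← intervalIntegral.integral_const_mul]
    refine intervalIntegral.integral_mono_on hpq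
      ((intervalIntegrable_sub_rpow hH s p q).const_mul _)
      (intervalIntegrable_kernel_integrand hH s p q) fun u hu => ?_
    exact mul_le_mul_of_nonneg_right
      (Real.rpow_le_rpow hs.le (hsp.trans hu.1) hα.le) (Real.rpow_nonneg (by linarith [hu.1]) _)
  rw [kernel_sub_kernel hH]
  have h1 : s ^ (1 / 2 - H) * s ^ (H - 1 / 2) = 1 := by
    rw [← Real.rpow_add hs]; simp
  have h2 : 0 ≤ cH H * (H - 1 / 2) * s ^ (1 / 2 - H) := by positivity
  refine le_trans (le_of_eq ?_) (mul_le_mul_of_nonneg_left key h2)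
  generalize (q - s) ^ (H - 1 / 2) - (p - s) ^ (H - 1 / 2) = d
  linear_combination (-1) * cH H * d * h1 -
    cH H * s ^ (1 / 2 - H) * s ^ (H - 1 / 2) * mul_div_cancel₀ d hα.ne'

lemma kernel_sub_kernel_le {H : ℝ} (hH : 1 / 2 < H) (hH' : H < 1) {s p q : ℝ} (hs : 0 < s)
    (hsp : s ≤ p) (hpq : p ≤ q) :
    kernel H q s - kernel H p s ≤ cH H * (q ^ (H - 1 / 2) * s ^ (1 / 2 - H)) *
      ((q - s) ^ (H - 1 / 2) - (p - s) ^ (H - 1 / 2)) := by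
  have hc := cH_pos hH hH'
  have hα : 0 < H - 1 / 2 := by linarith
  have key : ∫ u in p..q, u ^ (H - 1 / 2) * (u - s) ^ (H - 3 / 2) ≤
      q ^ (H - 1 / 2) * (((q - s) ^ (H - 1 / 2) - (p - s) ^ (H - 1 / 2)) / (H - 1 / 2)) := by
    rw [← integral_sub_rpow hH, ← intervalIntegral.integral_const_mul]
    refine intervalIntegral.integral_mono_on hpq (intervalIntegrable_kernel_integrand hH s p q)
      ((intervalIntegrable_sub_rpow hH s p q).const_mul _) fun u hu => ?_
    exact mul_le_mul_of_nonneg_right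
      (Real.rpow_le_rpow (by linarith [hu.1]) hu.2 hα.le) (Real.rpow_nonneg (by linarith [hu.1]) _)
  rw [kernel_sub_kernel hH]
  have h2 : 0 ≤ cH H * (H - 1 / 2) * s ^ (1 / 2 - H) := by positivity
  refine (mul_le_mul_of_nonneg_left key h2).trans (le_of_eq ?_)
  generalize (q - s) ^ (H - 1 / 2) - (p - s) ^ (H - 1 / 2) = d
  linear_combination cH H * s ^ (1 / 2 - H) * q ^ (H - 1 / 2) * mul_div_cancel₀ d hα.ne'

lemma kernel_le {H : ℝ} (hH : 1 / 2 < H) (hH' : H < 1) {s t : ℝ} (hs : 0 < s) (hst : s ≤ t) :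
    kernel H t s ≤ cH H * (t ^ (H - 1 / 2) * s ^ (1 / 2 - H)) * (t - s) ^ (H - 1 / 2) := by
  have h := kernel_sub_kernel_le hH hH' hs le_rfl hst
  rwa [kernel_self, sub_self, Real.zero_rpow (by linarith), sub_zero, sub_zero] at h

lemma le_kernel {H : ℝ} (hH : 1 / 2 < H) (hH' : H < 1) {s t : ℝ} (hs : 0 < s) (hst : s ≤ t) :
    cH H * (t - s) ^ (H - 1 / 2) ≤ kernel H t s := by
  have h := le_kernel_sub_kernel hH hH' hs le_rfl hst
  rwa [kernel_self, sub_self, Real.zero_rpow (by linarith), sub_zero, sub_zero] at h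

lemma intervalIntegrable_kernel {H : ℝ} (hH : 1 / 2 < H) (hH' : H < 1) {a b t : ℝ} (ha : 0 ≤ a)
    (hab : a ≤ b) (hbt : b ≤ t) : IntervalIntegrable (kernel H t) volume a b := by
  have hα : 0 < H - 1 / 2 := by linarith
  have hc := cH_pos hH hH'
  rw [intervalIntegrable_iff_integrableOn_Ioc_of_le hab]
  have hdom : IntegrableOn (fun s : ℝ => cH H * (t ^ (H - 1 / 2) * s ^ (1 / 2 - H)) *
      t ^ (H - 1 / 2)) (Set.Ioc a b) := by
    rw [← intervalIntegrable_iff_integrableOn_Ioc_of_le hab]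
    exact (((intervalIntegral.intervalIntegrable_rpow' (by linarith)).const_mul _).const_mul
      _).mul_const _
  refine Integrable.mono' hdom ?_ ?_
  -- The variable `s` is also a limit of integration. The indicator of the triangle `s < u ≤ t`
  -- turns the kernel into a parametric integral, to which measurability of partial integrals
  -- applies.
  · have hm : StronglyMeasurable (fun s : ℝ => cH H * (H - 1 / 2) * s ^ (1 / 2 - H) *
        ∫ u, (Set.indicator {z : ℝ × ℝ | z.1 < z.2 ∧ z.2 ≤ t}
          (fun z => z.2 ^ (H - 1 / 2) * (z.2 - z.1) ^ (H - 3 / 2))) (s, u)) := by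
      refine StronglyMeasurable.mul (Measurable.stronglyMeasurable (by fun_prop)) ?_
      refine StronglyMeasurable.integral_prod_right' (Measurable.stronglyMeasurable ?_)
      refine Measurable.indicator (by fun_prop) ?_
      exact (measurableSet_lt measurable_fst measurable_snd).inter
        (measurableSet_le measurable_snd measurable_const)
    refine hm.aestronglyMeasurable.congr ?_
    filter_upwards [ae_restrict_mem measurableSet_Ioc] with s hs
    rw [kernel, intervalIntegral.integral_of_le (hs.2.trans hbt),
      ← integral_indicator measurableSet_Ioc]
    rfl
  · filter_upwards [ae_restrict_mem measurableSet_Ioc] with s hs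
    have hs0 : 0 < s := ha.trans_lt hs.1
    have hst : s ≤ t := hs.2.trans hbt
    rw [Real.norm_of_nonneg (le_trans (mul_nonneg hc.le (Real.rpow_nonneg (by linarith) _))
      (le_kernel hH hH' hs0 hst))]
    refine (kernel_le hH hH' hs0 hst).trans ?_
    have : 0 < t := hs0.trans_le hst
    gcongr
    linarith

/-! ### Self-similarity and reduction to the integer time grid. -/

lemma kernel_div {H : ℝ} {N s t : ℝ} (hN : 0 < N) (hs : 0 ≤ s) (hst : s ≤ t) :
    kernel H (t / N) (s / N) = N ^ (1 / 2 - H) * kernel H t s := by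
  have h := intervalIntegral.integral_comp_div (a := s) (b := t)
    (fun u : ℝ => u ^ (H - 1 / 2) * (u - s / N) ^ (H - 3 / 2)) hN.ne'
  have h' : ∫ u in s..t, (u / N) ^ (H - 1 / 2) * (u / N - s / N) ^ (H - 3 / 2) =
      (N ^ (H - 1 / 2))⁻¹ * (N ^ (H - 3 / 2))⁻¹ *
        ∫ u in s..t, u ^ (H - 1 / 2) * (u - s) ^ (H - 3 / 2) := by
    rw [← intervalIntegral.integral_const_mul]
    refine intervalIntegral.integral_congr fun u hu => ?_
    rw [Set.uIcc_of_le hst] at hu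
    rw [← sub_div, Real.div_rpow (by linarith [hu.1]) hN.le,
      Real.div_rpow (by linarith [hu.1]) hN.le]
    ring
  rw [h', smul_eq_mul] at h
  have h2 : ∫ u in s / N..t / N, u ^ (H - 1 / 2) * (u - s / N) ^ (H - 3 / 2) =
      N⁻¹ * ((N ^ (H - 1 / 2))⁻¹ * (N ^ (H - 3 / 2))⁻¹ *
        ∫ u in s..t, u ^ (H - 1 / 2) * (u - s) ^ (H - 3 / 2)) := by
    rw [h, inv_mul_cancel_left₀ hN.ne']
  rw [kernel, kernel, h2, Real.div_rpow hs hN.le]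
  have e : (N ^ (1 / 2 - H))⁻¹ * (N⁻¹ * ((N ^ (H - 1 / 2))⁻¹ * (N ^ (H - 3 / 2))⁻¹)) =
      N ^ (1 / 2 - H) := by
    rw [← Real.rpow_neg hN.le, ← Real.rpow_neg hN.le, ← Real.rpow_neg hN.le, ← Real.rpow_neg_one,
      ← Real.rpow_add hN, ← Real.rpow_add hN, ← Real.rpow_add hN]
    congr 1; ring
  linear_combination (cH H * (H - 1 / 2) * s ^ (1 / 2 - H) *
    ∫ u in s..t, u ^ (H - 1 / 2) * (u - s) ^ (H - 3 / 2)) * e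

/-- The weight of the `i`-th past coin at time `n` on the integer time grid. -/
def pastWeight (H : ℝ) (n i : ℕ) : ℝ :=
  ∫ u in ((i : ℝ) - 1)..(i : ℝ), (kernel H n u - kernel H ((n : ℝ) - 1) u)

/-- The weight of the present coin at time `n` on the integer time grid. -/
def presentWeight (H : ℝ) (n : ℕ) : ℝ := ∫ u in ((n : ℝ) - 1)..(n : ℝ), kernel H n u

/-- The limit of `pastWeight H n (n - k)` as `n` tends to infinity. -/
def limitWeight (H : ℝ) (k : ℕ) : ℝ := 2 * (cH H / (H + 1 / 2)) * rho (H / 2 + 1 / 4) k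

/-- The three factors are the normalization of the market, the Jacobian of `u ↦ u / N`, and the
homogeneity of the kernel. -/
lemma sqrt_mul_rpow {N H : ℝ} (hN : 0 < N) :
    Real.sqrt N * (N⁻¹ * N ^ (1 / 2 - H)) = N ^ (-H) := by
  rw [Real.sqrt_eq_rpow, ← Real.rpow_neg_one, ← Real.rpow_add hN, ← Real.rpow_add hN]
  congr 1; ring

lemma J_eq {σ H : ℝ} {N n i : ℕ} (hN : 0 < N) (hi : 1 ≤ i) (hin : i < n) :
    J σ H N n i = σ * (N : ℝ) ^ (-H) * pastWeight H n i := by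
  have hN' : (0 : ℝ) < N := by exact_mod_cast hN
  have hi' : (1 : ℝ) ≤ i := by exact_mod_cast hi
  have hin' : (i : ℝ) ≤ n - 1 := by
    have : (i : ℝ) + 1 ≤ n := by exact_mod_cast hin
    linarith
  have h := intervalIntegral.integral_comp_div (a := (i : ℝ) - 1) (b := i)
    (fun u : ℝ => kernel H (n / N) u - kernel H ((n - 1) / N) u) hN'.ne'
  have h' : ∫ u in ((i : ℝ) - 1)..i, (kernel H (n / N) (u / N) - kernel H ((n - 1) / N) (u / N)) =
      (N : ℝ) ^ (1 / 2 - H) * pastWeight H n i := by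
    rw [pastWeight, ← intervalIntegral.integral_const_mul]
    refine intervalIntegral.integral_congr fun u hu => ?_
    rw [Set.uIcc_of_le (by linarith)] at hu
    rw [kernel_div hN' (by linarith [hu.1]) (by linarith [hu.2]),
      kernel_div hN' (by linarith [hu.1]) (by linarith [hu.2])]
    ring
  rw [h', smul_eq_mul] at h
  rw [J, ← sqrt_mul_rpow hN', mul_assoc σ, mul_assoc σ, mul_assoc (√(N : ℝ)),
    mul_assoc (N : ℝ)⁻¹, h, inv_mul_cancel_left₀ hN'.ne']

lemma g_eq {σ H : ℝ} {N n : ℕ} (hN : 0 < N) (hn : 1 ≤ n) :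
    g σ H N n = σ * (N : ℝ) ^ (-H) * presentWeight H n := by
  have hN' : (0 : ℝ) < N := by exact_mod_cast hN
  have hi' : (1 : ℝ) ≤ n := by exact_mod_cast hn
  have h := intervalIntegral.integral_comp_div (a := (n : ℝ) - 1) (b := n)
    (fun u : ℝ => kernel H (n / N) u) hN'.ne'
  have h' : ∫ u in ((n : ℝ) - 1)..n, kernel H (n / N) (u / N) =
      (N : ℝ) ^ (1 / 2 - H) * presentWeight H n := by
    rw [presentWeight, ← intervalIntegral.integral_const_mul]
    refine intervalIntegral.integral_congr fun u hu => ?_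
    rw [Set.uIcc_of_le (by linarith)] at hu
    rw [kernel_div hN' (by linarith [hu.1]) (by linarith [hu.2])]
  rw [h', smul_eq_mul] at h
  rw [g, ← sqrt_mul_rpow hN', mul_assoc σ, mul_assoc σ, mul_assoc (√(N : ℝ)),
    mul_assoc (N : ℝ)⁻¹, h, inv_mul_cancel_left₀ hN'.ne']

/-! ### The limit weights: positivity, square summability, divergent sum. -/

lemma add_one_rpow_sub_le {x p : ℝ} (hx : 0 < x) (hp : 0 ≤ p) (hp1 : p ≤ 1) :
    (x + 1) ^ p - x ^ p ≤ p * x ^ (p - 1) := by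
  have h := rpow_one_add_le_one_add_mul_self (s := 1 / x) (p := p)
    (by linarith [one_div_pos.2 hx]) hp hp1
  have e : x + 1 = x * (1 + 1 / x) := by field_simp
  rw [e, Real.mul_rpow hx.le (by positivity), Real.rpow_sub hx, Real.rpow_one]
  have := mul_le_mul_of_nonneg_left h (Real.rpow_nonneg hx.le p)
  calc x ^ p * (1 + 1 / x) ^ p - x ^ p ≤ x ^ p * (1 + p * (1 / x)) - x ^ p := by linarith
    _ = p * (x ^ p / x) := by ring

lemma integral_const_sub_rpow {H : ℝ} (hH : 1 / 2 < H) (x a b : ℝ) :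
    ∫ v in a..b, (x - v) ^ (H - 1 / 2) =
      ((x - a) ^ (H + 1 / 2) - (x - b) ^ (H + 1 / 2)) / (H + 1 / 2) := by
  rw [intervalIntegral.integral_comp_sub_left (fun v : ℝ => v ^ (H - 1 / 2)) x,
    integral_rpow (Or.inl (by linarith))]
  have : H - 1 / 2 + 1 = H + 1 / 2 := by ring
  rw [this]

lemma continuous_sub_rpow {H : ℝ} (hH : 1 / 2 < H) (x : ℝ) :
    Continuous fun v : ℝ => (x - v) ^ (H - 1 / 2) :=
  (Real.continuous_rpow_const (by linarith)).comp (by fun_prop : Continuous fun v : ℝ => x - v)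

lemma intervalIntegrable_rpow_sub_rpow {H : ℝ} (hH : 1 / 2 < H) (x a b : ℝ) :
    IntervalIntegrable (fun v : ℝ => (x - v) ^ (H - 1 / 2) - (x - 1 - v) ^ (H - 1 / 2))
      volume a b :=
  ((continuous_sub_rpow hH x).sub (continuous_sub_rpow hH (x - 1))).intervalIntegrable _ _

/-- Integrating a first difference of `x ^ (H - 1/2)` over a unit cell gives a second difference of
`x ^ (H + 1/2)`, and `H + 1/2 = 2 * h` for the `h` of `rho`. -/
lemma limitWeight_eq_integral {H : ℝ} (hH : 1 / 2 < H) {n i : ℕ} (hin : i ≤ n) :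
    limitWeight H (n - i) = ∫ v in ((i : ℝ) - 1)..(i : ℝ),
      cH H * (((n : ℝ) - v) ^ (H - 1 / 2) - ((n : ℝ) - 1 - v) ^ (H - 1 / 2)) := by
  rw [intervalIntegral.integral_const_mul, intervalIntegral.integral_sub
    ((continuous_sub_rpow hH _).intervalIntegrable _ _)
    ((continuous_sub_rpow hH _).intervalIntegrable _ _),
    integral_const_sub_rpow hH, integral_const_sub_rpow hH, limitWeight, rho, Nat.cast_sub hin]
  have e1 : 2 * (H / 2 + 1 / 4) = H + 1 / 2 := by ring
  have e2 : (n : ℝ) - (i - 1) = n - i + 1 := by ring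
  have e3 : (n : ℝ) - 1 - (i - 1) = n - i := by ring
  have e4 : (n : ℝ) - 1 - i = n - i - 1 := by ring
  rw [e1, e2, e3, e4]
  ring

lemma limitWeight_pos {H : ℝ} (hH : 1 / 2 < H) (hH' : H < 1) {k : ℕ} (hk : 1 ≤ k) :
    0 < limitWeight H k := by
  have hk' : (1 : ℝ) ≤ k := by exact_mod_cast hk
  -- The integral depends only on `n - i`; the cell `[-1, 0]`, with `i = 0`, represents the lag `k`
  -- directly.
  have h := limitWeight_eq_integral hH (Nat.zero_le k)
  rw [Nat.sub_zero] at h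
  rw [h]
  refine intervalIntegral.intervalIntegral_pos_of_pos_on
    ((intervalIntegrable_rpow_sub_rpow hH _ _ _).const_mul _) (fun v hv => ?_) (by simp)
  have hv2 : v < 0 := by simpa using hv.2
  exact mul_pos (cH_pos hH hH') (sub_pos.2
    (Real.rpow_lt_rpow (by linarith) (by linarith) (by linarith)))

lemma limitWeight_succ_le {H : ℝ} (hH : 1 / 2 < H) (hH' : H < 1) {k : ℕ} (hk : 1 ≤ k) :
    limitWeight H (k + 1) ≤ cH H * ((H - 1 / 2) * (k : ℝ) ^ (H - 3 / 2)) := by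
  have hk' : (1 : ℝ) ≤ k := by exact_mod_cast hk
  have h := limitWeight_eq_integral hH (Nat.zero_le (k + 1))
  rw [Nat.sub_zero] at h
  rw [h]
  have hb : ∀ v ∈ Set.Icc (((0 : ℕ) : ℝ) - 1) ((0 : ℕ) : ℝ), cH H *
      ((((k + 1 : ℕ) : ℝ) - v) ^ (H - 1 / 2) - (((k + 1 : ℕ) : ℝ) - 1 - v) ^ (H - 1 / 2)) ≤
      cH H * ((H - 1 / 2) * (k : ℝ) ^ (H - 3 / 2)) := by
    intro v hv
    have hv2 : v ≤ 0 := by simpa using hv.2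
    refine mul_le_mul_of_nonneg_left ?_ (cH_pos hH hH').le
    have h1 := add_one_rpow_sub_le (x := k - v) (p := H - 1 / 2) (by linarith) (by linarith)
      (by linarith)
    have e : H - 1 / 2 - 1 = H - 3 / 2 := by ring
    rw [e] at h1
    have h2 : ((k : ℝ) - v) ^ (H - 3 / 2) ≤ (k : ℝ) ^ (H - 3 / 2) :=
      Real.rpow_le_rpow_of_nonpos (by linarith) (by linarith) (by linarith)
    have h3 := mul_le_mul_of_nonneg_left h2 (by linarith : 0 ≤ H - 1 / 2)
    push_cast
    have e1 : (k : ℝ) + 1 - v = k - v + 1 := by ring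
    have e2 : (k : ℝ) + 1 - 1 - v = k - v := by ring
    rw [e1, e2]
    linarith
  refine (intervalIntegral.integral_mono_on (by simp)
    ((intervalIntegrable_rpow_sub_rpow hH _ _ _).const_mul _)
    intervalIntegrable_const hb).trans (le_of_eq ?_)
  simp

lemma summable_limitWeight_sq {H : ℝ} (hH : 1 / 2 < H) (hH' : H < 1) :
    Summable fun k => limitWeight H (k + 1) ^ 2 := by
  -- The bound in `limitWeight_succ_le` needs `k ≥ 1`, so the first term is split off. The squares
  -- are then of order `k ^ (2 * H - 3)`, with exponent below `-1`.
  rw [← summable_nat_add_iff 1]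
  have hs : Summable fun k : ℕ => (cH H * (H - 1 / 2)) ^ 2 * ((k + 1 : ℕ) : ℝ) ^ (2 * H - 3) :=
    ((summable_nat_add_iff 1).2 (Real.summable_nat_rpow.2 (by linarith))).mul_left _
  refine Summable.of_nonneg_of_le (fun k => sq_nonneg _) (fun k => ?_) hs
  refine (pow_le_pow_left₀ (limitWeight_pos hH hH' (by omega)).le
    (limitWeight_succ_le hH hH' (k := k + 1) (by omega)) 2).trans (le_of_eq ?_)
  rw [← mul_assoc, mul_pow, ← Real.rpow_natCast (((k + 1 : ℕ) : ℝ) ^ (H - 3 / 2)), ← Real.rpow_mul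
    (by positivity)]
  congr 2
  push_cast; ring

lemma sum_rho (h : ℝ) (hh : 0 < h) (m : ℕ) :
    ∑ k ∈ Finset.range m, rho h (k + 1) =
      1 / 2 * (((m : ℝ) + 1) ^ (2 * h) - (m : ℝ) ^ (2 * h) - 1) := by
  induction m with
  | zero => simp [Real.zero_rpow (by linarith : 2 * h ≠ 0)]
  | succ m ih =>
    rw [Finset.sum_range_succ, ih, rho]
    push_cast
    rw [add_sub_cancel_right]
    ring

/-- The telescoped sum grows at least like `m ^ (2 * h - 1)`, because `(m + 1) ^ (2 * h) ≥ (m + 1) *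
m ^ (2 * h - 1)`. -/
lemma tendsto_sum_rho {h : ℝ} (hh : 1 / 2 < h) :
    Tendsto (fun m => ∑ k ∈ Finset.range m, rho h (k + 1)) atTop atTop := by
  have h1 : Tendsto (fun m : ℕ => 1 / 2 * ((m : ℝ) ^ (2 * h - 1) + (-1))) atTop atTop :=
    (tendsto_atTop_add_const_right _ _ ((tendsto_rpow_atTop (by linarith)).comp
      tendsto_natCast_atTop_atTop)).const_mul_atTop (by norm_num)
  refine tendsto_atTop_mono (fun m => ?_) h1
  rw [sum_rho h (by linarith)]
  have hm : (0 : ℝ) ≤ m := m.cast_nonneg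
  have e1 : ((m : ℝ) + 1) ^ (2 * h) = ((m : ℝ) + 1) ^ (2 * h - 1) * (m + 1) := by
    rw [← Real.rpow_add_one (by positivity)]; congr 1; ring
  have e2 : (m : ℝ) ^ (2 * h) = (m : ℝ) ^ (2 * h - 1) * m := by
    rw [← Real.rpow_add_one' hm (by linarith)]; congr 1; ring
  have h2 : (m : ℝ) ^ (2 * h - 1) ≤ ((m : ℝ) + 1) ^ (2 * h - 1) :=
    Real.rpow_le_rpow hm (by linarith) (by linarith)
  rw [e1, e2]
  nlinarith

/-! ### Convergence of the coin weights. -/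

lemma intervalIntegrable_kernel_sub {H : ℝ} (hH : 1 / 2 < H) (hH' : H < 1) {n i : ℕ}
    (hi : 1 ≤ i) (hin : i < n) :
    IntervalIntegrable (fun u => kernel H n u - kernel H ((n : ℝ) - 1) u) volume
      ((i : ℝ) - 1) (i : ℝ) := by
  have hi' : (1 : ℝ) ≤ i := by exact_mod_cast hi
  have hin' : (i : ℝ) + 1 ≤ n := by exact_mod_cast hin
  exact (intervalIntegrable_kernel hH hH' (by linarith) (by linarith) (by linarith)).sub
    (intervalIntegrable_kernel hH hH' (by linarith) (by linarith) (by linarith))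

lemma limitWeight_le_pastWeight {H : ℝ} (hH : 1 / 2 < H) (hH' : H < 1) {n i : ℕ}
    (hi : 1 ≤ i) (hin : i < n) : limitWeight H (n - i) ≤ pastWeight H n i := by
  have hi' : (1 : ℝ) ≤ i := by exact_mod_cast hi
  have hin' : (i : ℝ) + 1 ≤ n := by exact_mod_cast hin
  rw [limitWeight_eq_integral hH hin.le, pastWeight]
  -- The open interval matters when `i = 1`: the kernel bounds require `s > 0`.
  refine intervalIntegral.integral_mono_on_of_le_Ioo (by linarith)
    ((intervalIntegrable_rpow_sub_rpow hH _ _ _).const_mul _)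
    (intervalIntegrable_kernel_sub hH hH' hi hin) fun v hv => ?_
  exact le_kernel_sub_kernel hH hH' (by linarith [hv.1]) (by linarith [hv.2]) (by linarith)

lemma rpow_mul_rpow_le_div_rpow {H a v t : ℝ} (hH : 1 / 2 < H) (ha : 0 < a) (hav : a ≤ v)
    (ht : 0 ≤ t) : t ^ (H - 1 / 2) * v ^ (1 / 2 - H) ≤ (t / a) ^ (H - 1 / 2) := by
  rw [← neg_sub H, Real.rpow_neg (by linarith), ← div_eq_mul_inv,
    ← Real.div_rpow ht (by linarith)]
  exact Real.rpow_le_rpow (div_nonneg ht (by linarith))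
    (div_le_div_of_nonneg_left ht ha hav) (by linarith)

lemma pastWeight_le_mul_limitWeight {H : ℝ} (hH : 1 / 2 < H) (hH' : H < 1) {n i : ℕ}
    (hi : 2 ≤ i) (hin : i < n) :
    pastWeight H n i ≤ ((n : ℝ) / (i - 1)) ^ (H - 1 / 2) * limitWeight H (n - i) := by
  have hi' : (2 : ℝ) ≤ i := by exact_mod_cast hi
  have hin' : (i : ℝ) + 1 ≤ n := by exact_mod_cast hin
  rw [limitWeight_eq_integral hH hin.le, pastWeight, ← intervalIntegral.integral_const_mul]
  refine intervalIntegral.integral_mono_on (by linarith)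
    (intervalIntegrable_kernel_sub hH hH' (by omega) hin)
    (((intervalIntegrable_rpow_sub_rpow hH _ _ _).const_mul _).const_mul _) fun v hv => ?_
  refine (kernel_sub_kernel_le hH hH' (s := v) (by linarith [hv.1]) (by linarith [hv.2])
    (by linarith)).trans ?_
  have hd : 0 ≤ ((n : ℝ) - v) ^ (H - 1 / 2) - ((n : ℝ) - 1 - v) ^ (H - 1 / 2) :=
    sub_nonneg.2 (Real.rpow_le_rpow (by linarith [hv.2]) (by linarith) (by linarith))
  rw [mul_left_comm _ (cH H), mul_assoc]
  refine mul_le_mul_of_nonneg_left (mul_le_mul_of_nonneg_right ?_ hd) (cH_pos hH hH').le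
  exact rpow_mul_rpow_le_div_rpow hH (by linarith) hv.1 (by linarith)

/-- Covers the singular cell `i = 1` together with the others. With `x = 1 - 1 / i` in `[0, 1]`, it
reduces to `x ≤ x ^ (1 - p)`. -/
lemma integral_rpow_neg_le {p : ℝ} (hp : 0 ≤ p) (hp1 : p < 1) {i : ℕ} (hi : 1 ≤ i) :
    ∫ v in ((i : ℝ) - 1)..(i : ℝ), v ^ (-p) ≤ (1 - p)⁻¹ * (i : ℝ) ^ (-p) := by
  have hi' : (1 : ℝ) ≤ i := by exact_mod_cast hi
  have hi0 : (0 : ℝ) < i := by linarith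
  rw [integral_rpow (Or.inl (by linarith)), div_eq_inv_mul, neg_add_eq_sub]
  refine mul_le_mul_of_nonneg_left ?_ (by linarith [inv_pos.2 (sub_pos.2 hp1)])
  have e : (i : ℝ) - 1 = i * (1 - 1 / i) := by field_simp
  have h01 : 0 ≤ 1 - 1 / (i : ℝ) := sub_nonneg.2 ((div_le_one hi0).2 hi')
  have h1 : 1 - 1 / (i : ℝ) ≤ (1 - 1 / (i : ℝ)) ^ (1 - p) := by
    rcases h01.eq_or_lt with h | h
    · rw [← h, Real.zero_rpow (by linarith)]
    · conv_lhs => rw [← Real.rpow_one (1 - 1 / (i : ℝ))]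
      exact Real.rpow_le_rpow_of_exponent_ge h (by linarith [one_div_pos.2 hi0]) (by linarith)
  rw [e, Real.mul_rpow hi0.le h01]
  have h2 := mul_le_mul_of_nonneg_left h1 (Real.rpow_nonneg hi0.le (1 - p))
  have e2 : (i : ℝ) ^ (1 - p) * (1 / i) = (i : ℝ) ^ (-p) := by
    rw [one_div, ← Real.rpow_neg_one, ← Real.rpow_add hi0]; congr 1; ring
  linarith

/-- Meant for coins near time `0`, where comparison with `limitWeight` degenerates: the singularity
`s ^ (1/2 - H)` is integrated instead of being bounded pointwise. -/
lemma pastWeight_le {H : ℝ} (hH : 1 / 2 < H) (hH' : H < 1) {n i : ℕ} (hi : 1 ≤ i)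
    (hin : i + 2 ≤ n) :
    pastWeight H n i ≤ cH H * (n : ℝ) ^ (H - 1 / 2) *
      ((H - 1 / 2) * ((n : ℝ) - 1 - i) ^ (H - 3 / 2)) *
      ((3 / 2 - H)⁻¹ * (i : ℝ) ^ (1 / 2 - H)) := by
  have hi' : (1 : ℝ) ≤ i := by exact_mod_cast hi
  have hin' : (i : ℝ) + 2 ≤ n := by exact_mod_cast hin
  have hc := cH_pos hH hH'
  have hI := integral_rpow_neg_le (p := H - 1 / 2) (by linarith) (by linarith) hi
  have e1 : -(H - 1 / 2) = 1 / 2 - H := by ring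
  have e2 : 1 - (H - 1 / 2) = 3 / 2 - H := by ring
  rw [e1, e2] at hI
  have hα : 0 < H - 1 / 2 := by linarith
  have hk : 0 ≤ ((n : ℝ) - 1 - i) ^ (H - 3 / 2) := Real.rpow_nonneg (by linarith) _
  refine le_trans ?_ (mul_le_mul_of_nonneg_left hI (by positivity))
  rw [pastWeight, ← intervalIntegral.integral_const_mul]
  refine intervalIntegral.integral_mono_on_of_le_Ioo (by linarith)
    (intervalIntegrable_kernel_sub hH hH' hi (by omega))
    ((intervalIntegral.intervalIntegrable_rpow' (by linarith)).const_mul _) fun v hv => ?_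
  have hv0 : 0 < v := by linarith [hv.1]
  refine (kernel_sub_kernel_le hH hH' hv0 (by linarith [hv.2]) (by linarith)).trans ?_
  have h1 := add_one_rpow_sub_le (x := n - 1 - v) (p := H - 1 / 2) (by linarith [hv.2])
    hα.le (by linarith)
  have e3 : (n : ℝ) - 1 - v + 1 = n - v := by ring
  have e4 : H - 1 / 2 - 1 = H - 3 / 2 := by ring
  rw [e3, e4] at h1
  have h2 : ((n : ℝ) - 1 - v) ^ (H - 3 / 2) ≤ ((n : ℝ) - 1 - i) ^ (H - 3 / 2) :=
    Real.rpow_le_rpow_of_nonpos (by linarith) (by linarith [hv.2]) (by linarith)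
  have h3 := h1.trans (mul_le_mul_of_nonneg_left h2 hα.le)
  refine (mul_le_mul_of_nonneg_left h3 (by positivity)).trans (le_of_eq (by ring))

lemma presentWeight_bounds {H : ℝ} (hH : 1 / 2 < H) (hH' : H < 1) {n : ℕ} (hn : 2 ≤ n) :
    cH H / (H + 1 / 2) ≤ presentWeight H n ∧
      presentWeight H n ≤ ((n : ℝ) / (n - 1)) ^ (H - 1 / 2) * (cH H / (H + 1 / 2)) := by
  have hn' : (2 : ℝ) ≤ n := by exact_mod_cast hn
  have hc := cH_pos hH hH'
  have hcont := continuous_sub_rpow hH (n : ℝ)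
  have e : cH H / (H + 1 / 2) =
      ∫ v in ((n : ℝ) - 1)..(n : ℝ), cH H * ((n : ℝ) - v) ^ (H - 1 / 2) := by
    rw [intervalIntegral.integral_const_mul, integral_const_sub_rpow hH, sub_self, sub_sub_cancel,
      Real.one_rpow, Real.zero_rpow (by linarith), sub_zero, mul_one_div]
  have hk : IntervalIntegrable (kernel H n) volume ((n : ℝ) - 1) n :=
    intervalIntegrable_kernel hH hH' (by linarith) (by linarith) le_rfl
  rw [e]
  constructor
  · exact intervalIntegral.integral_mono_on (by linarith)
      ((hcont.intervalIntegrable _ _).const_mul _) hk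
      fun v hv => le_kernel hH hH' (by linarith [hv.1]) hv.2
  · rw [← intervalIntegral.integral_const_mul]
    refine intervalIntegral.integral_mono_on (by linarith) hk
      (((hcont.intervalIntegrable _ _).const_mul _).const_mul _) fun v hv => ?_
    refine (kernel_le hH hH' (by linarith [hv.1]) hv.2).trans ?_
    rw [mul_left_comm _ (cH H), mul_assoc]
    refine mul_le_mul_of_nonneg_left (mul_le_mul_of_nonneg_right ?_
      (Real.rpow_nonneg (by linarith [hv.2]) _)) hc.le
    exact rpow_mul_rpow_le_div_rpow hH (by linarith) hv.1 (by linarith)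

lemma tendsto_div_sub_rpow (c p : ℝ) :
    Tendsto (fun n : ℕ => ((n : ℝ) / (n - c)) ^ p) atTop (𝓝 1) := by
  have h : Tendsto (fun n : ℕ => (n : ℝ) / (n - c)) atTop (𝓝 1) := by
    simpa [sub_eq_add_neg] using tendsto_natCast_div_add_atTop (-c)
  simpa using h.rpow_const (Or.inl one_ne_zero)

lemma tendsto_presentWeight {H : ℝ} (hH : 1 / 2 < H) (hH' : H < 1) :
    Tendsto (presentWeight H) atTop (𝓝 (cH H / (H + 1 / 2))) := by
  refine tendsto_of_tendsto_of_tendsto_of_le_of_le' tendsto_const_nhds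
    (g := fun _ => cH H / (H + 1 / 2))
    (h := fun n : ℕ => ((n : ℝ) / (n - 1)) ^ (H - 1 / 2) * (cH H / (H + 1 / 2)))
    (by simpa using (tendsto_div_sub_rpow 1 (H - 1 / 2)).mul_const (cH H / (H + 1 / 2))) ?_ ?_
  · filter_upwards [eventually_ge_atTop 2] with n hn using (presentWeight_bounds hH hH' hn).1
  · filter_upwards [eventually_ge_atTop 2] with n hn using (presentWeight_bounds hH hH' hn).2

lemma pastWeight_sub_limitWeight_nonneg {H : ℝ} (hH : 1 / 2 < H) (hH' : H < 1) {n k : ℕ}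
    (hk : k + 2 ≤ n) : 0 ≤ pastWeight H n (n - 1 - k) - limitWeight H (k + 1) := by
  have h := limitWeight_le_pastWeight hH hH' (n := n) (i := n - 1 - k) (by omega) (by omega)
  rw [show n - (n - 1 - k) = k + 1 by omega] at h
  exact sub_nonneg.2 h

lemma pastWeight_sub_limitWeight_le {H : ℝ} (hH : 1 / 2 < H) (hH' : H < 1) {n k : ℕ}
    (hk : k + 3 ≤ n) : pastWeight H n (n - 1 - k) - limitWeight H (k + 1) ≤
      (((n : ℝ) / (n - (k + 2))) ^ (H - 1 / 2) - 1) * limitWeight H (k + 1) := by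
  have h := pastWeight_le_mul_limitWeight hH hH' (n := n) (i := n - 1 - k) (by omega) (by omega)
  rw [show n - (n - 1 - k) = k + 1 by omega] at h
  have e : ((n - 1 - k : ℕ) : ℝ) - 1 = n - (k + 2) := by
    rw [Nat.sub_sub, Nat.cast_sub (by omega)]; push_cast; ring
  rw [e] at h
  linarith

lemma tendsto_pastWeight {H : ℝ} (hH : 1 / 2 < H) (hH' : H < 1) (k : ℕ) :
    Tendsto (fun n => pastWeight H n (n - 1 - k) - limitWeight H (k + 1)) atTop (𝓝 0) := by
  have h := ((tendsto_div_sub_rpow ((k : ℝ) + 2) (H - 1 / 2)).sub_const 1).mul_const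
    (limitWeight H (k + 1))
  rw [sub_self, zero_mul] at h
  refine tendsto_of_tendsto_of_tendsto_of_le_of_le' tendsto_const_nhds h ?_ ?_
  · filter_upwards [eventually_ge_atTop (k + 2)] with n hn using
      pastWeight_sub_limitWeight_nonneg hH hH' hn
  · filter_upwards [eventually_ge_atTop (k + 3)] with n hn using
      pastWeight_sub_limitWeight_le hH hH' hn

/-- Dominated convergence. For lags up to about `n / 2` the base `n / (n - (k + 2))` is at most `2`,
so the error is at most `(2 ^ (H - 1/2) - 1) * limitWeight H (k + 1)`, hence at most the limit
weight, whose square is summable. -/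
lemma tendsto_sum_recent {H : ℝ} (hH : 1 / 2 < H) (hH' : H < 1) :
    Tendsto (fun n => ∑ k ∈ Finset.range (n - 1), if 2 * (k + 2) ≤ n then
      (pastWeight H n (n - 1 - k) - limitWeight H (k + 1)) ^ 2 else 0) atTop (𝓝 0) := by
  have h := tendsto_tsum_of_dominated_convergence (𝓕 := atTop)
    (f := fun (n k : ℕ) => if 2 * (k + 2) ≤ n then
      (pastWeight H n (n - 1 - k) - limitWeight H (k + 1)) ^ 2 else 0) (g := fun _ => 0)
    (summable_limitWeight_sq hH hH') (fun k => ?_) (Eventually.of_forall fun n k => ?_)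
  · rw [tsum_zero] at h
    refine h.congr fun n => tsum_eq_sum fun k hk => if_neg ?_
    rw [Finset.mem_range] at hk
    omega
  · have h := (tendsto_pastWeight hH hH' k).pow 2
    rw [zero_pow two_ne_zero] at h
    refine h.congr' ?_
    filter_upwards [eventually_ge_atTop (2 * (k + 2))] with n hn
    rw [if_pos hn]
  · split_ifs with hk
    · have hL := (limitWeight_pos hH hH' (k := k + 1) (by omega)).le
      rw [Real.norm_of_nonneg (sq_nonneg _)]
      refine pow_le_pow_left₀ (pastWeight_sub_limitWeight_nonneg hH hH' (by omega)) ?_ 2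
      refine (pastWeight_sub_limitWeight_le hH hH' (by omega)).trans ?_
      refine mul_le_of_le_one_left hL ?_
      have hk' : 2 * ((k : ℝ) + 2) ≤ n := by exact_mod_cast hk
      have hk0 : (0 : ℝ) ≤ k := k.cast_nonneg
      have h2 : (n : ℝ) / (n - (k + 2)) ≤ 2 := (div_le_iff₀ (by linarith)).2 (by linarith)
      have h3 : ((n : ℝ) / (n - (k + 2))) ^ (H - 1 / 2) ≤ 2 ^ (H - 1 / 2) :=
        Real.rpow_le_rpow (div_nonneg (by linarith) (by linarith)) h2 (by linarith)
      have h4 : (2 : ℝ) ^ (H - 1 / 2) ≤ 2 ^ (1 : ℝ) :=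
        Real.rpow_le_rpow_of_exponent_le one_le_two (by linarith)
      rw [Real.rpow_one] at h4
      linarith
    · rw [norm_zero]; exact sq_nonneg _

/-- The direct bound on the square is `n ^ (4 * H - 4) * (i + 1) ^ (1 - 2 * H)`, which is not
summable in `i` uniformly. Since `i + 1 ≤ n`, the part `n ^ (3 * (H - 1))` may be traded for the
same power of `i + 1`. This yields the summable exponent `H - 2` and still leaves the vanishing
factor `n ^ (H - 1)`. -/
lemma exists_pastWeight_sq_le {H : ℝ} (hH : 1 / 2 < H) (hH' : H < 1) :
    ∃ C, ∀ n i : ℕ, 5 ≤ n → 2 * i < n →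
      pastWeight H n (i + 1) ^ 2 ≤ C * ((n : ℝ) ^ (H - 1) * ((i + 1 : ℕ) : ℝ) ^ (H - 2)) := by
  have hc := cH_pos hH hH'
  refine ⟨(cH H * ((H - 1 / 2) * 5⁻¹ ^ (H - 3 / 2)) * (3 / 2 - H)⁻¹) ^ 2, fun n i hn hi => ?_⟩
  have hn' : (5 : ℝ) ≤ n := by exact_mod_cast hn
  have hn0 : (0 : ℝ) < n := by linarith
  have hi' : 2 * (i : ℝ) + 1 ≤ n := by exact_mod_cast hi
  have hi0 : (0 : ℝ) < ((i + 1 : ℕ) : ℝ) := by positivity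
  have hin : ((i + 1 : ℕ) : ℝ) ≤ n := by push_cast; linarith
  have h0 : 0 ≤ pastWeight H n (i + 1) :=
    (limitWeight_pos hH hH' (k := n - (i + 1)) (by omega)).le.trans
      (limitWeight_le_pastWeight hH hH' (by omega) (by omega))
  have h1 := pastWeight_le hH hH' (n := n) (i := i + 1) (by omega) (by omega)
  -- From `2 * i + 1 ≤ n` the base is at least `(n - 3) / 2`, which is at least `n / 5` as soon as
  -- `n ≥ 5`.
  have h2 : ((n : ℝ) - 1 - (i + 1 : ℕ)) ^ (H - 3 / 2) ≤ (5⁻¹ * n) ^ (H - 3 / 2) :=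
    Real.rpow_le_rpow_of_nonpos (by positivity) (by push_cast; linarith) (by linarith)
  have hα : 0 ≤ H - 1 / 2 := by linarith
  have hβ : 0 ≤ (3 / 2 - H)⁻¹ := inv_nonneg.2 (by linarith)
  have h3 : pastWeight H n (i + 1) ≤ (cH H * ((H - 1 / 2) * 5⁻¹ ^ (H - 3 / 2)) * (3 / 2 - H)⁻¹) *
      ((n : ℝ) ^ (2 * H - 2) * ((i + 1 : ℕ) : ℝ) ^ (1 / 2 - H)) := by
    refine h1.trans ?_
    have e : (n : ℝ) ^ (2 * H - 2) = (n : ℝ) ^ (H - 1 / 2) * (n : ℝ) ^ (H - 3 / 2) := by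
      rw [← Real.rpow_add hn0]; congr 1; ring
    calc _ ≤ cH H * (n : ℝ) ^ (H - 1 / 2) * ((H - 1 / 2) * (5⁻¹ * n) ^ (H - 3 / 2)) *
          ((3 / 2 - H)⁻¹ * ((i + 1 : ℕ) : ℝ) ^ (1 / 2 - H)) := by gcongr
      _ = _ := by rw [Real.mul_rpow (by norm_num) hn0.le, e]; ring
  refine (pow_le_pow_left₀ h0 h3 2).trans ?_
  rw [mul_pow]
  refine mul_le_mul_of_nonneg_left ?_ (sq_nonneg _)
  rw [mul_pow, ← Real.rpow_natCast, ← Real.rpow_natCast (((i + 1 : ℕ) : ℝ) ^ _),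
    ← Real.rpow_mul hn0.le, ← Real.rpow_mul hi0.le]
  have e1 : (n : ℝ) ^ ((2 * H - 2) * (2 : ℕ)) = (n : ℝ) ^ (H - 1) * (n : ℝ) ^ (3 * (H - 1)) := by
    rw [← Real.rpow_add hn0]; congr 1; push_cast; ring
  have e2 : ((i + 1 : ℕ) : ℝ) ^ (3 * (H - 1)) * ((i + 1 : ℕ) : ℝ) ^ ((1 / 2 - H) * (2 : ℕ)) =
      ((i + 1 : ℕ) : ℝ) ^ (H - 2) := by
    rw [← Real.rpow_add hi0]; congr 1; push_cast; ring
  rw [e1, mul_assoc, ← e2]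
  exact mul_le_mul_of_nonneg_left (mul_le_mul_of_nonneg_right
    (Real.rpow_le_rpow_of_nonpos hi0 hin (by linarith)) (by positivity)) (by positivity)

lemma tendsto_sum_distant {H : ℝ} (hH : 1 / 2 < H) (hH' : H < 1) :
    Tendsto (fun n => ∑ k ∈ Finset.range (n - 1), if 2 * (k + 2) ≤ n then 0 else
      (pastWeight H n (n - 1 - k) - limitWeight H (k + 1)) ^ 2) atTop (𝓝 0) := by
  obtain ⟨C, hC⟩ := exists_pastWeight_sq_le hH hH'
  have hs : Summable fun i : ℕ => ((i + 1 : ℕ) : ℝ) ^ (H - 2) :=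
    (summable_nat_add_iff 1).2 (Real.summable_nat_rpow.2 (by linarith))
  have hC0 : 0 ≤ C := by
    have h := (sq_nonneg _).trans (hC 5 0 le_rfl (by norm_num))
    exact nonneg_of_mul_nonneg_left h (by positivity)
  have hlim : Tendsto (fun n : ℕ => C * ((n : ℝ) ^ (H - 1) * ∑' i : ℕ, ((i + 1 : ℕ) : ℝ) ^ (H - 2)))
      atTop (𝓝 0) := by
    have h := (tendsto_rpow_neg_atTop (y := 1 - H) (by linarith)).comp
      (tendsto_natCast_atTop_atTop (R := ℝ))
    have h' := (h.mul_const (∑' i : ℕ, ((i + 1 : ℕ) : ℝ) ^ (H - 2))).const_mul C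
    simpa using h'
  refine tendsto_of_tendsto_of_tendsto_of_le_of_le' tendsto_const_nhds hlim
    (Eventually.of_forall fun n => Finset.sum_nonneg fun k _ => ?_) ?_
  · split_ifs
    exacts [le_rfl, sq_nonneg _]
  · filter_upwards [eventually_ge_atTop 5] with n hn
    rw [← Finset.sum_range_reflect]
    calc _ ≤ ∑ i ∈ Finset.range (n - 1), C * ((n : ℝ) ^ (H - 1) * ((i + 1 : ℕ) : ℝ) ^ (H - 2)) := by
          refine Finset.sum_le_sum fun i hi => ?_
          rw [Finset.mem_range] at hi
          split_ifs with h
          · positivity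
          -- Since `0 < limitWeight ≤ pastWeight`, the difference is at most the past weight itself.
          · refine le_trans ?_ (hC n i hn (by omega))
            have h1 := pastWeight_sub_limitWeight_nonneg hH hH' (n := n) (k := n - 1 - 1 - i)
              (by omega)
            rw [show n - 1 - (n - 1 - 1 - i) = i + 1 by omega] at h1 ⊢
            refine pow_le_pow_left₀ h1 ?_ 2
            have h2 := limitWeight_pos hH hH' (k := n - 1 - 1 - i + 1) (by omega)
            linarith
      _ ≤ _ := by
          rw [← Finset.mul_sum, ← Finset.mul_sum]
          gcongr
          exact hs.sum_le_tsum _ fun i _ => by positivity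

/-- The weights of the past coins converge in `ℓ²` to the limit weights. -/
lemma tendsto_sum_pastWeight_sub_limitWeight_sq {H : ℝ} (hH : 1 / 2 < H) (hH' : H < 1) :
    Tendsto (fun n => ∑ k ∈ Finset.range (n - 1),
      (pastWeight H n (n - 1 - k) - limitWeight H (k + 1)) ^ 2) atTop (𝓝 0) := by
  have h := (tendsto_sum_recent hH hH').add (tendsto_sum_distant hH hH')
  rw [add_zero] at h
  refine h.congr fun n => ?_
  rw [← Finset.sum_add_distrib]
  refine Finset.sum_congr rfl fun k _ => ?_
  split_ifs <;> simp

/-! ### Random series with independent signs. -/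

/-- A sequence of independent symmetric signs. -/
structure IsCoinSequence {Ω : Type*} [MeasurableSpace Ω] (P : Measure Ω) (ξ : ℕ → Ω → ℝ) :
    Prop where
  measurable : ∀ k, Measurable (ξ k)
  indep : iIndepFun ξ P
  up : ∀ k, P {ω | ξ k ω = 1} = 1 / 2
  down : ∀ k, P {ω | ξ k ω = -1} = 1 / 2

/-- The value of the series `∑ b k * x k`. -/
def seriesValue (b x : ℕ → ℝ) : ℝ :=
  limUnder atTop fun m => ∑ k ∈ Finset.range m, b k * x k

lemma seriesValue_eq {b x : ℕ → ℝ} {l : ℝ}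
    (h : Tendsto (fun m => ∑ k ∈ Finset.range m, b k * x k) atTop (𝓝 l)) :
    seriesValue b x = l := h.limUnder_eq

lemma measurable_seriesValue (b : ℕ → ℝ) : Measurable (seriesValue b) := by
  refine (StronglyMeasurable.limUnder (l := atTop)
    (f := fun (m : ℕ) (x : ℕ → ℝ) => ∑ k ∈ Finset.range m, b k * x k) fun m => ?_).measurable
  exact Measurable.stronglyMeasurable (by fun_prop)

namespace IsCoinSequence

variable {Ω : Type*} [MeasurableSpace Ω] {P : Measure Ω} {ξ : ℕ → Ω → ℝ}

lemma measurable_joint (hξ : IsCoinSequence P ξ) : Measurable fun ω k => ξ k ω :=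
  measurable_pi_iff.2 hξ.measurable

/-- Multiplying the coins by deterministic signs yields a sequence of coins again. -/
lemma mul_sign (hξ : IsCoinSequence P ξ) {ε : ℕ → ℝ} (hε : ∀ k, ε k = 1 ∨ ε k = -1) :
    IsCoinSequence P fun k ω => ε k * ξ k ω where
  measurable k := (hξ.measurable k).const_mul _
  indep := hξ.indep.comp (fun k x => ε k * x) fun k => measurable_const_mul _
  up k := by
    rcases hε k with h | h
    · simpa [h] using hξ.up k
    · simpa [h, neg_eq_iff_eq_neg] using hξ.down k
  down k := by
    rcases hε k with h | h
    · simpa [h] using hξ.down k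
    · simpa [h] using hξ.up k

lemma measure_signs (hξ : IsCoinSequence P ξ) (S : Finset ℕ) {c : ℕ → ℝ}
    (hc : ∀ k, c k = 1 ∨ c k = -1) : P {ω | ∀ k ∈ S, ξ k ω = c k} = (1 / 2) ^ S.card := by
  have h := hξ.indep.measure_inter_preimage_eq_mul S (sets := fun k => {c k})
    fun k _ => measurableSet_singleton _
  have e : {ω | ∀ k ∈ S, ξ k ω = c k} = ⋂ k ∈ S, ξ k ⁻¹' {c k} := by ext; simp
  rw [e, h, ← Finset.prod_const]
  refine Finset.prod_congr rfl fun k _ => ?_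
  rcases hc k with hk | hk
  · rw [hk]; exact hξ.up k
  · rw [hk]; exact hξ.down k

lemma measurable_series (hξ : IsCoinSequence P ξ) (b : ℕ → ℝ) :
    Measurable fun ω => seriesValue b fun k => ξ k ω :=
  (measurable_seriesValue b).comp hξ.measurable_joint

variable [IsProbabilityMeasure P]

lemma ae_eq (hξ : IsCoinSequence P ξ) : ∀ᵐ ω ∂P, ∀ k, ξ k ω = 1 ∨ ξ k ω = -1 := by
  refine ae_all_iff.2 fun k => ?_
  have h1 : MeasurableSet {ω | ξ k ω = 1} := hξ.measurable k (measurableSet_singleton 1)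
  have h2 : MeasurableSet {ω | ξ k ω = -1} := hξ.measurable k (measurableSet_singleton (-1))
  have h : P ({ω | ξ k ω = 1} ∪ {ω | ξ k ω = -1}) = 1 := by
    rw [measure_union _ h2, hξ.up, hξ.down, ENNReal.add_halves]
    refine Set.disjoint_left.2 fun ω h1 h2 => ?_
    rw [Set.mem_ofPred_eq] at h1 h2
    linarith
  exact (prob_compl_eq_zero_iff (h1.union h2)).2 h

lemma map_eq (hξ : IsCoinSequence P ξ) (k : ℕ) :
    P.map (ξ k) = (1 / 2 : ENNReal) • Measure.dirac 1 + (1 / 2 : ENNReal) • Measure.dirac (-1) := by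
  have hae : ∀ᵐ x ∂P.map (ξ k), x ∈ ({1} ∪ {-1} : Set ℝ) := by
    rw [ae_map_iff (hξ.measurable k).aemeasurable (by measurability)]
    filter_upwards [hξ.ae_eq] with ω hω using hω k
  rw [← Measure.restrict_eq_self_of_ae_mem hae, Measure.restrict_union (by norm_num)
    (measurableSet_singleton _), Measure.restrict_singleton, Measure.restrict_singleton,
    Measure.map_apply (hξ.measurable k) (measurableSet_singleton _),
    Measure.map_apply (hξ.measurable k) (measurableSet_singleton _)]
  exact congrArg₂ (fun p q => p • Measure.dirac 1 + q • Measure.dirac (-1)) (hξ.up k) (hξ.down k)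

/-- The joint law of the coins is invariant under deterministic sign changes. -/
lemma measure_mul_sign (hξ : IsCoinSequence P ξ) {ε : ℕ → ℝ} (hε : ∀ k, ε k = 1 ∨ ε k = -1)
    {A : Set (ℕ → ℝ)} (hA : MeasurableSet A) :
    P {ω | (fun k => ε k * ξ k ω) ∈ A} = P {ω | (fun k => ξ k ω) ∈ A} := by
  have h' := hξ.mul_sign hε
  have h : P.map (fun ω k => ε k * ξ k ω) = P.map fun ω k => ξ k ω := by
    rw [h'.indep.map_fun_eq_infinitePi_map h'.measurable,
      hξ.indep.map_fun_eq_infinitePi_map hξ.measurable]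
    simp_rw [h'.map_eq, hξ.map_eq]
  have e := congrArg (fun μ => μ A) h
  rwa [Measure.map_apply h'.measurable_joint hA, Measure.map_apply hξ.measurable_joint hA] at e

lemma memLp (hξ : IsCoinSequence P ξ) (p : ENNReal) (k : ℕ) : MemLp (ξ k) p P := by
  refine MemLp.of_bound (hξ.measurable k).aestronglyMeasurable 1 ?_
  filter_upwards [hξ.ae_eq] with ω hω
  rcases hω k with h | h <;> simp [h]

lemma integral_eq_zero (hξ : IsCoinSequence P ξ) (k : ℕ) : ∫ ω, ξ k ω ∂P = 0 := by
  have h : ∫ x, x ∂(P.map (ξ k)) = ∫ ω, ξ k ω ∂P :=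
    integral_map (hξ.measurable k).aemeasurable (by fun_prop)
  rw [← h, hξ.map_eq k, integral_add_measure, integral_smul_measure, integral_smul_measure,
    integral_dirac, integral_dirac]
  · simp
  · exact (integrable_dirac (by simp)).smul_measure (by simp)
  · exact (integrable_dirac (by simp)).smul_measure (by simp)

lemma integral_mul (hξ : IsCoinSequence P ξ) (i j : ℕ) :
    ∫ ω, ξ i ω * ξ j ω ∂P = if i = j then 1 else 0 := by
  split_ifs with h
  · subst h
    have : ∀ᵐ ω ∂P, ξ i ω * ξ i ω = 1 := by
      filter_upwards [hξ.ae_eq] with ω hω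
      rcases hω i with h | h <;> simp [h]
    rw [integral_congr_ae this]
    simp
  · rw [(hξ.indep.indepFun h).integral_fun_mul_eq_mul_integral
      (hξ.measurable i).aestronglyMeasurable (hξ.measurable j).aestronglyMeasurable,
      hξ.integral_eq_zero, zero_mul]

lemma memLp_sum (hξ : IsCoinSequence P ξ) (p : ENNReal) (c : ℕ → ℝ) (m : ℕ) :
    MemLp (fun ω => ∑ k ∈ Finset.range m, c k * ξ k ω) p P :=
  memLp_finsetSum _ fun k _ => (hξ.memLp p k).const_mul (c k)

lemma integral_sum_sq (hξ : IsCoinSequence P ξ) (c : ℕ → ℝ) (m : ℕ) :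
    ∫ ω, (∑ k ∈ Finset.range m, c k * ξ k ω) ^ 2 ∂P = ∑ k ∈ Finset.range m, c k ^ 2 := by
  have hint : ∀ i j, Integrable (fun ω => c i * ξ i ω * (c j * ξ j ω)) P := fun i j =>
    ((hξ.memLp 2 i).const_mul (c i)).integrable_mul ((hξ.memLp 2 j).const_mul (c j))
  simp_rw [pow_two, Finset.sum_mul_sum]
  rw [integral_finsetSum _ fun i _ => integrable_finsetSum _ fun j _ => hint i j]
  refine Finset.sum_congr rfl fun i hi => ?_
  rw [integral_finsetSum _ fun j _ => hint i j, Finset.sum_eq_single_of_mem i hi]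
  · rw [← mul_one (c i * c i), ← if_pos (rfl : i = i) (c := i = i) (t := (1 : ℝ)) (e := 0),
      ← hξ.integral_mul i i, ← integral_const_mul]
    congr 1; ext ω; ring
  · intro j _ hj
    have := hξ.integral_mul i j
    rw [if_neg hj.symm] at this
    rw [← mul_zero (c i * c j), ← this, ← integral_const_mul]
    congr 1; ext ω; ring

lemma eLpNorm_sum (hξ : IsCoinSequence P ξ) (c : ℕ → ℝ) (m : ℕ) :
    eLpNorm (fun ω => ∑ k ∈ Finset.range m, c k * ξ k ω) 2 P =
      ENNReal.ofReal (√(∑ k ∈ Finset.range m, c k ^ 2)) := by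
  rw [(hξ.memLp_sum 2 c m).eLpNorm_eq_integral_rpow_norm two_ne_zero ENNReal.ofNat_ne_top,
    Real.sqrt_eq_rpow, ← hξ.integral_sum_sq]
  simp

lemma ae_exists_tendsto (hξ : IsCoinSequence P ξ) {b : ℕ → ℝ} (hb : Summable fun k => b k ^ 2) :
    ∀ᵐ ω ∂P, ∃ l, Tendsto (fun m => ∑ k ∈ Finset.range m, b k * ξ k ω) atTop (𝓝 l) := by
  have hsm : ∀ k, StronglyMeasurable (ξ k) := fun k => (hξ.measurable k).stronglyMeasurable
  -- The natural filtration at `m` already contains `ξ m`, hence the shift to `m + 1`. The `L²`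
  -- bound below gives the `L¹` bound required for martingale convergence.
  have hmart : Martingale (fun m ω => ∑ k ∈ Finset.range (m + 1), b k * ξ k ω)
      (Filtration.natural ξ hsm) P := by
    refine martingale_of_condExp_sub_eq_zero_nat (fun m => ?_)
      (fun m => (hξ.memLp_sum 1 b (m + 1)).integrable le_rfl) fun m => ?_
    · refine Finset.stronglyMeasurable_fun_sum _ fun k hk => StronglyMeasurable.const_mul ?_ _
      exact (Filtration.stronglyAdapted_natural hsm).stronglyMeasurable_le
        (Nat.lt_succ_iff.1 (Finset.mem_range.1 hk))
    · have e : (fun ω => ∑ k ∈ Finset.range (m + 1 + 1), b k * ξ k ω) -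
          (fun ω => ∑ k ∈ Finset.range (m + 1), b k * ξ k ω) = b (m + 1) • ξ (m + 1) := by
        ext ω
        simp [Finset.sum_range_succ _ (m + 1)]
      rw [e]
      filter_upwards [condExp_smul (b (m + 1)) (ξ (m + 1)) (Filtration.natural ξ hsm m) (μ := P),
        hξ.indep.condExp_natural_ae_eq_of_lt hsm (Nat.lt_succ_self m)] with ω h1 h2
      rw [h1, Pi.smul_apply, h2, hξ.integral_eq_zero, smul_zero, Pi.zero_apply]
  have hbdd : ∀ m, eLpNorm (fun ω => ∑ k ∈ Finset.range (m + 1), b k * ξ k ω) 1 P ≤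
      ((√(∑' k, b k ^ 2)).toNNReal : ENNReal) := fun m => by
    refine (eLpNorm_le_eLpNorm_of_exponent_le one_le_two
      (hξ.memLp_sum 2 b (m + 1)).aestronglyMeasurable).trans ?_
    rw [hξ.eLpNorm_sum]
    exact ENNReal.ofReal_le_ofReal (Real.sqrt_le_sqrt (hb.sum_le_tsum _ fun k _ => sq_nonneg _))
  filter_upwards [hmart.submartingale.exists_ae_tendsto_of_bdd hbdd] with ω ⟨l, hl⟩
  exact ⟨l, (tendsto_add_atTop_iff_nat 1).1 hl⟩

/-- A random series with square summable coefficients converges almost surely. -/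
lemma ae_tendsto_seriesValue (hξ : IsCoinSequence P ξ) {b : ℕ → ℝ}
    (hb : Summable fun k => b k ^ 2) :
    ∀ᵐ ω ∂P, Tendsto (fun m => ∑ k ∈ Finset.range m, b k * ξ k ω) atTop
      (𝓝 (seriesValue b fun k => ξ k ω)) := by
  filter_upwards [hξ.ae_exists_tendsto hb] with ω h using tendsto_nhds_limUnder h

/-- The law of a random series with positive square summable coefficients has no atoms. -/
lemma measure_series_eq (hξ : IsCoinSequence P ξ) {b : ℕ → ℝ} (hb : Summable fun k => b k ^ 2)
    (hpos : ∀ k, 0 < b k) (y : ℝ) : P {ω | (seriesValue b fun k => ξ k ω) = y} = 0 := by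
  have hb0 : Tendsto b atTop (𝓝 0) := by
    have h := hb.tendsto_atTop_zero.sqrt
    rw [Real.sqrt_zero] at h
    exact h.congr fun k => Real.sqrt_sq (hpos k).le
  have hV := hξ.measurable_series b
  -- Flipping coin `n` preserves the law and moves the series by exactly `2 * b n`. As `b n` is
  -- positive and tends to `0`, each outcome lies in only finitely many of the events on the right,
  -- so their probabilities tend to `0`.
  have hle : ∀ n, P {ω | (seriesValue b fun k => ξ k ω) = y} ≤
      P {ω | |(seriesValue b fun k => ξ k ω) - y| = 2 * b n} := by
    intro n
    have hε : ∀ k, (Function.update (fun _ => 1) n (-1) : ℕ → ℝ) k = 1 ∨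
        (Function.update (fun _ => 1) n (-1) : ℕ → ℝ) k = -1 := by
      intro k
      rcases eq_or_ne k n with h | h
      · subst h; simp
      · simp [h]
    have hA : MeasurableSet {x : ℕ → ℝ | seriesValue b x = y} :=
      measurable_seriesValue b (measurableSet_singleton y)
    rw [← Set.preimage_ofPred_eq (p := fun x => seriesValue b x = y) (f := fun ω k => ξ k ω)]
    refine (hξ.measure_mul_sign hε hA).symm.le.trans (measure_mono_ae ?_)
    filter_upwards [hξ.ae_eq, hξ.ae_tendsto_seriesValue hb] with ω h1 h2 h3
    have h4 : seriesValue b (fun k => (Function.update (fun _ => 1) n (-1) : ℕ → ℝ) k * ξ k ω) =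
        (seriesValue b fun k => ξ k ω) - 2 * b n * ξ n ω := by
      refine seriesValue_eq ((h2.sub_const (2 * b n * ξ n ω)).congr' ?_)
      filter_upwards [eventually_gt_atTop n] with m hm
      rw [sub_eq_iff_eq_add, ← sub_eq_iff_eq_add', ← Finset.sum_sub_distrib,
        Finset.sum_eq_single_of_mem n (Finset.mem_range.2 hm)]
      · simp; ring
      · intro k _ hk
        simp [hk]
    have h5 : seriesValue b (fun k => (Function.update (fun _ => 1) n (-1) : ℕ → ℝ) k * ξ k ω) = y :=
      h3
    have h6 : (seriesValue b fun k => ξ k ω) - y = 2 * b n * ξ n ω := by linarith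
    change |_| = _
    rw [h6, abs_mul, abs_of_pos (by linarith [hpos n])]
    rcases h1 n with h | h <;> simp [h]
  have hlim : Tendsto (fun n => P {ω | |(seriesValue b fun k => ξ k ω) - y| = 2 * b n}) atTop
      (𝓝 (P ∅)) := by
    refine tendsto_measure_of_ae_tendsto_indicator_of_isFiniteMeasure _ .empty
      (fun n => (hV.sub_const y).abs (measurableSet_singleton _)) (ae_of_all _ fun ω => ?_)
    simp only [Set.mem_ofPred_eq, Set.mem_empty_iff_false, iff_false]
    rcases (abs_nonneg ((seriesValue b fun k => ξ k ω) - y)).eq_or_lt with h | h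
    · exact Eventually.of_forall fun n hn => by linarith [hpos n]
    · filter_upwards [(hb0.const_mul 2).eventually_lt_const ((mul_zero (2 : ℝ)).trans_lt h)] with n hn h'
      linarith
  rw [measure_empty] at hlim
  exact le_antisymm (ge_of_tendsto' hlim hle) zero_le

/-- A random series whose coefficients are not summable exceeds every level with positive
probability. -/
lemma measure_lt_series_pos (hξ : IsCoinSequence P ξ) {b : ℕ → ℝ}
    (hb : Summable fun k => b k ^ 2)
    (hdiv : Tendsto (fun m => ∑ k ∈ Finset.range m, b k) atTop atTop) (y : ℝ) :
    0 < P {ω | y < seriesValue b fun k => ξ k ω} := by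
  -- With the first `m` coins equal to `1` (event `F`), the partial sum exceeds `y`; it remains to
  -- have a nonnegative tail (event `G`).
  obtain ⟨m, hm⟩ := (hdiv.eventually_gt_atTop y).exists
  set F : Set (ℕ → ℝ) := {x | ∀ k ∈ Finset.range m, x k = 1} with hF
  set G : Set (ℕ → ℝ) := {x | ∑ k ∈ Finset.range m, b k * x k ≤ seriesValue b x} with hG
  have hFm : MeasurableSet F := by
    have : F = ⋂ k ∈ Finset.range m, {x : ℕ → ℝ | x k = 1} := by ext; simp [hF]
    rw [this]
    exact Finset.measurableSet_biInter _ fun k _ =>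
      measurableSet_eq_fun (measurable_pi_apply k) measurable_const
  have hGm : MeasurableSet G := measurableSet_le (by fun_prop) (measurable_seriesValue b)
  have hε : ∀ k, (if k < m then 1 else -1 : ℝ) = 1 ∨ (if k < m then 1 else -1 : ℝ) = -1 := by
    intro k; split_ifs <;> simp
  have hPF : P {ω | (fun k => ξ k ω) ∈ F} ≠ 0 := by
    have h := hξ.measure_signs (Finset.range m) (c := fun _ => 1) fun _ => Or.inl rfl
    rw [hF]
    refine ne_of_eq_of_ne h (pow_ne_zero _ (by simp))
  -- Flipping all coins from `m` on preserves `F` and negates the tail, so a negative tail is no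
  -- likelier than a nonnegative one.
  have hflip : P {ω | (fun k => ξ k ω) ∈ F ∧ (fun k => ξ k ω) ∉ G} ≤
      P {ω | (fun k => ξ k ω) ∈ F ∩ G} := by
    rw [← hξ.measure_mul_sign hε (hFm.inter hGm)]
    refine measure_mono_ae ?_
    filter_upwards [hξ.ae_tendsto_seriesValue hb] with ω h2 h3
    obtain ⟨h3, h4⟩ : (fun k => ξ k ω) ∈ F ∧ (fun k => ξ k ω) ∉ G := h3
    have h5 : ∀ k ∈ Finset.range m, (if k < m then 1 else -1 : ℝ) * ξ k ω = ξ k ω := fun k hk => by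
      rw [if_pos (Finset.mem_range.1 hk), one_mul]
    have h5' : ∑ k ∈ Finset.range m, b k * ((if k < m then 1 else -1 : ℝ) * ξ k ω) =
        ∑ k ∈ Finset.range m, b k * ξ k ω := Finset.sum_congr rfl fun k hk => by rw [h5 k hk]
    have h6 : seriesValue b (fun k => (if k < m then 1 else -1 : ℝ) * ξ k ω) =
        2 * ∑ k ∈ Finset.range m, b k * ξ k ω - seriesValue b fun k => ξ k ω := by
      refine seriesValue_eq ((h2.const_sub (2 * ∑ k ∈ Finset.range m, b k * ξ k ω)).congr' ?_)
      filter_upwards [eventually_ge_atTop m] with M hM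
      have h7 : ∑ k ∈ Finset.Ico m M, b k * ((if k < m then 1 else -1 : ℝ) * ξ k ω) =
          -∑ k ∈ Finset.Ico m M, b k * ξ k ω := by
        rw [← Finset.sum_neg_distrib]
        refine Finset.sum_congr rfl fun k hk => ?_
        rw [if_neg (not_lt.2 (Finset.mem_Ico.1 hk).1)]
        ring
      rw [← Finset.sum_range_add_sum_Ico _ hM, ← Finset.sum_range_add_sum_Ico _ hM, h5', h7]
      ring
    refine ⟨fun k hk => (h5 k hk).trans (h3 k hk), ?_⟩
    have h7 : seriesValue b (fun k => ξ k ω) < ∑ k ∈ Finset.range m, b k * ξ k ω := not_le.1 h4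
    change ∑ k ∈ Finset.range m, b k * ((if k < m then 1 else -1 : ℝ) * ξ k ω) ≤
      seriesValue b (fun k => (if k < m then 1 else -1 : ℝ) * ξ k ω)
    rw [h6, h5']
    linarith
  have hFG : P {ω | (fun k => ξ k ω) ∈ F ∩ G} ≠ 0 := by
    intro h0
    rw [h0] at hflip
    refine hPF (le_antisymm ?_ zero_le)
    refine (measure_mono (t := {ω | (fun k => ξ k ω) ∈ F ∩ G} ∪
      {ω | (fun k => ξ k ω) ∈ F ∧ (fun k => ξ k ω) ∉ G}) fun ω h => ?_).trans
      ((measure_union_le _ _).trans (by rw [h0, zero_add]; exact hflip))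
    by_cases hω : (fun k => ξ k ω) ∈ G
    · exact Or.inl ⟨h, hω⟩
    · exact Or.inr ⟨h, hω⟩
  refine (pos_iff_ne_zero.2 hFG).trans_le (measure_mono fun ω h => ?_)
  refine hm.trans_le (le_trans (le_of_eq ?_) h.2)
  exact Finset.sum_congr rfl fun k hk => by rw [h.1 k hk, mul_one]

end IsCoinSequence

/-! ### Limits of exceedance probabilities, and counting by means of coins. -/

/-- The sign of a real number, as a unit of the integers; it is meant for arguments `±1`. -/
def toSign (x : ℝ) : ℤˣ := open Classical in if x = 1 then 1 else -1

lemma coe_toSign {x : ℝ} (hx : x = 1 ∨ x = -1) : ((toSign x : ℤ) : ℝ) = x := by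
  rcases hx with h | h
  · simp [toSign, h]
  · have : (-1 : ℝ) ≠ 1 := by norm_num
    simp [toSign, h, this]

lemma measurableSet_toSign_eq (u : ℤˣ) : MeasurableSet {x | toSign x = u} := by
  rcases Int.units_eq_one_or u with rfl | rfl
  · convert measurableSet_singleton (1 : ℝ)
    ext x
    by_cases hx : x = 1 <;> simp [toSign, hx]
  · convert (measurableSet_singleton (1 : ℝ)).compl
    ext x
    by_cases hx : x = 1 <;> simp [toSign, hx]

namespace IsCoinSequence

variable {Ω : Type*} [MeasurableSpace Ω] {P : Measure Ω} [IsProbabilityMeasure P] {ξ : ℕ → Ω → ℝ}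

/-- The sums with coefficients `c n k - b k` tend to `0` in `L²`, hence almost surely along
subsequences. The boundary event, where the series equals `γ₀` or `-γ₀`, is null because the law has
no atoms; this also makes `≤` and `<` interchangeable in the limit. -/
lemma tendsto_measure_le_abs_sum_add (hξ : IsCoinSequence P ξ) {b : ℕ → ℝ}
    (hb : Summable fun k => b k ^ 2) (hpos : ∀ k, 0 < b k) {c : ℕ → ℕ → ℝ} {m : ℕ → ℕ}
    (hm : Tendsto m atTop atTop)
    (hc : Tendsto (fun n => ∑ k ∈ Finset.range (m n), (c n k - b k) ^ 2) atTop (𝓝 0))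
    {e γ : ℕ → ℝ} {γ₀ : ℝ} (he : Tendsto e atTop (𝓝 0)) (hγ : Tendsto γ atTop (𝓝 γ₀)) :
    Tendsto (fun n => P {ω | γ n ≤ |∑ k ∈ Finset.range (m n), c n k * ξ k ω + e n|}) atTop
      (𝓝 (P {ω | γ₀ < |seriesValue b fun k => ξ k ω|})) := by
  have hD : TendstoInMeasure P
      (fun n ω => ∑ k ∈ Finset.range (m n), (c n k - b k) * ξ k ω) atTop (fun _ => 0) := by
    refine tendstoInMeasure_of_tendsto_eLpNorm (p := 2) two_ne_zero
      (fun n => (hξ.memLp_sum 2 _ _).aestronglyMeasurable) aestronglyMeasurable_const ?_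
    have h := ENNReal.tendsto_ofReal hc.sqrt
    rw [Real.sqrt_zero, ENNReal.ofReal_zero] at h
    refine h.congr fun n => ?_
    rw [← hξ.eLpNorm_sum]
    congr 1
    ext ω
    simp
  have hV := hξ.measurable_series b
  refine tendsto_of_subseq_tendsto fun ns hns => ?_
  obtain ⟨ms, hms, hlim⟩ := (hD.comp hns).exists_seq_tendsto_ae
  refine ⟨ms, ?_⟩
  have hs : Tendsto (fun i => ns (ms i)) atTop atTop := hns.comp hms.tendsto_atTop
  refine tendsto_measure_of_ae_tendsto_indicator_of_isFiniteMeasure _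
    (measurableSet_lt measurable_const hV.abs) (fun i => measurableSet_le measurable_const
      (((Finset.measurable_fun_sum _ fun k _ =>
        (hξ.measurable k).const_mul _).add_const _).abs)) ?_
  have hne : ∀ y, ∀ᵐ ω ∂P, (seriesValue b fun k => ξ k ω) ≠ y := fun y =>
    measure_eq_zero_iff_ae_notMem.1 (hξ.measure_series_eq hb hpos y)
  filter_upwards [hlim, hξ.ae_tendsto_seriesValue hb, hne γ₀, hne (-γ₀)] with ω h1 h2 h3 h4
  have h5 : Tendsto (fun i => |∑ k ∈ Finset.range (m (ns (ms i))), c (ns (ms i)) k * ξ k ω +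
      e (ns (ms i))| - γ (ns (ms i))) atTop (𝓝 (|seriesValue b fun k => ξ k ω| - γ₀)) := by
    have h := ((h1.add (h2.comp (hm.comp hs))).add (he.comp hs)).abs.sub (hγ.comp hs)
    rw [zero_add, add_zero] at h
    refine h.congr fun i => ?_
    simp only [Function.comp_apply, sub_mul, Finset.sum_sub_distrib, sub_add_cancel]
  have h6 : |seriesValue b fun k => ξ k ω| - γ₀ ≠ 0 := by
    intro h
    rcases abs_cases (seriesValue b fun k => ξ k ω) with h' | h'
    · exact h3 (by linarith)
    · exact h4 (by linarith)
  rcases lt_or_gt_of_ne h6 with h | h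
  · filter_upwards [h5.eventually_lt_const h] with i hi
    constructor <;> intro <;> linarith
  · filter_upwards [h5.eventually_const_lt h] with i hi
    constructor <;> intro <;> linarith

/-- The first `m` coins, read backwards, are uniformly distributed on `{-1, 1}^m`. -/
lemma ncard_div_two_pow (hξ : IsCoinSequence P ξ) {m : ℕ} (A : Set (Fin m → ℤˣ)) :
    (A.ncard : ℝ) / 2 ^ m =
      P.real {ω | (fun i : Fin m => toSign (ξ (Fin.rev i) ω)) ∈ A} := by
  classical
  have hmeas : ∀ x : Fin m → ℤˣ, MeasurableSet
      ((fun ω => fun i : Fin m => toSign (ξ (Fin.rev i) ω)) ⁻¹' {x}) := fun x => by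
    have e : (fun ω => fun i : Fin m => toSign (ξ (Fin.rev i) ω)) ⁻¹' {x} =
        ⋂ i : Fin m, ξ (Fin.rev i) ⁻¹' {y | toSign y = x i} := by
      ext ω
      simp [funext_iff]
    rw [e]
    exact MeasurableSet.iInter fun i => hξ.measurable _ (measurableSet_toSign_eq (x i))
  have hx : ∀ x : Fin m → ℤˣ,
      P.real ((fun ω => fun i : Fin m => toSign (ξ (Fin.rev i) ω)) ⁻¹' {x}) = (1 / 2) ^ m := by
    intro x
    have h := hξ.measure_signs (Finset.range m)
      (c := fun k => if hk : k < m then ((x (Fin.rev ⟨k, hk⟩) : ℤ) : ℝ) else 1) fun k => by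
        split_ifs with hk
        · rcases Int.units_eq_one_or (x (Fin.rev ⟨k, hk⟩)) with h | h <;> simp [h]
        · exact Or.inl rfl
    rw [Finset.card_range] at h
    have h' : P ((fun ω => fun i : Fin m => toSign (ξ (Fin.rev i) ω)) ⁻¹' {x}) = (1 / 2) ^ m := by
      rw [← h]
      refine measure_congr ?_
      filter_upwards [hξ.ae_eq] with ω hω
      refine propext ?_
      change (fun i : Fin m => toSign (ξ (Fin.rev i) ω)) = x ↔ ∀ k ∈ Finset.range m, ξ k ω =
        if hk : k < m then ((x (Fin.rev ⟨k, hk⟩) : ℤ) : ℝ) else 1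
      constructor
      · rintro rfl k hk
        rw [dif_pos (Finset.mem_range.1 hk)]
        simp only [Fin.rev_rev]
        rw [coe_toSign (hω k)]
      · intro h
        ext i
        have h1 := h (Fin.rev i) (Finset.mem_range.2 (Fin.rev i).isLt)
        rw [dif_pos (Fin.rev i).isLt, Fin.eta, Fin.rev_rev] at h1
        have h2 := coe_toSign (hω (Fin.rev i))
        rw [h1] at h2
        rw [h1]
        exact_mod_cast h2
    rw [measureReal_def, h']
    simp
  have hsum := sum_measureReal_preimage_singleton (μ := P)
    (f := fun ω => fun i : Fin m => toSign (ξ (Fin.rev i) ω)) A.toFinset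
    (fun y _ => hmeas y)
  rw [Finset.sum_congr rfl fun x _ => hx x, Finset.sum_const, nsmul_eq_mul, Set.coe_toFinset,
    ← Set.ncard_eq_toFinset_card'] at hsum
  rw [div_eq_mul_one_div, ← one_div_pow, hsum]
  rfl

end IsCoinSequence

/-! ### Proportion of arbitrage points at a single level. -/

lemma summable_mul_rho_sq {σ H : ℝ} (hH : 1 / 2 < H) (hH' : H < 1) :
    Summable fun k => (2 * gLim σ H * rho (H / 2 + 1 / 4) (k + 1)) ^ 2 := by
  refine ((summable_limitWeight_sq hH hH').mul_left (σ ^ 2)).congr fun k => ?_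
  rw [limitWeight, gLim]
  ring

lemma mul_rho_pos {σ H : ℝ} (hH : 1 / 2 < H) (hH' : H < 1) (hσ : 0 < σ) (k : ℕ) :
    0 < 2 * gLim σ H * rho (H / 2 + 1 / 4) (k + 1) := by
  have h := mul_pos hσ (limitWeight_pos hH hH' (k := k + 1) (by omega))
  rw [limitWeight] at h
  rw [gLim]
  linarith [h, show σ * (2 * (cH H / (H + 1 / 2)) * rho (H / 2 + 1 / 4) (k + 1)) =
    2 * (σ * cH H / (H + 1 / 2)) * rho (H / 2 + 1 / 4) (k + 1) by ring]

lemma gLim_pos {σ H : ℝ} (hH : 1 / 2 < H) (hH' : H < 1) (hσ : 0 < σ) : 0 < gLim σ H :=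
  div_pos (mul_pos hσ (cH_pos hH hH')) (by linarith)

lemma limitPartialSum_eq {Ω : Type*} (σ H : ℝ) (ξ : ℕ → Ω → ℝ) (m : ℕ) (ω : Ω) :
    limitPartialSum σ H ξ m ω =
      ∑ k ∈ Finset.range m, 2 * gLim σ H * rho (H / 2 + 1 / 4) (k + 1) * ξ k ω := by
  rw [limitPartialSum, Finset.mul_sum]
  exact Finset.sum_congr rfl fun k _ => by ring

lemma limitVar_eq {Ω : Type*} (σ H : ℝ) (ξ : ℕ → Ω → ℝ) (ω : Ω) :
    limitVar σ H ξ ω =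
      seriesValue (fun k => 2 * gLim σ H * rho (H / 2 + 1 / 4) (k + 1)) fun k => ξ k ω := by
  simp only [limitVar, limitPartialSum_eq, seriesValue]

/-- The no-arbitrage condition on the integer time grid. -/
lemma mem_arbitrageLevel_iff {σ H : ℝ} {a : ℝ → ℝ} {N n : ℕ} (hN : 0 < N) (hn : 1 ≤ n)
    (x : Level n) : x ∈ arbitrageLevel σ H a N n ↔
      σ * presentWeight H n ≤ |∑ k ∈ Finset.range (n - 1), σ * pastWeight H n (n - 1 - k) *
        (if hk : k < n - 1 then ((x (Fin.rev ⟨k, hk⟩) : ℤ) : ℝ) else 0) +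
          (N : ℝ) ^ H * drift a N n| := by
  have hN' : (0 : ℝ) < N := by exact_mod_cast hN
  set r := (N : ℝ) ^ H with hr
  have hr0 : 0 < r := Real.rpow_pos_of_pos hN' _
  have hr' : (N : ℝ) ^ (-H) = r⁻¹ := Real.rpow_neg hN'.le _
  set S := ∑ k ∈ Finset.range (n - 1), σ * pastWeight H n (n - 1 - k) *
        (if hk : k < n - 1 then ((x (Fin.rev ⟨k, hk⟩) : ℤ) : ℝ) else 0) with hS
  -- Summation is reversed, so that `k` counts backwards from the most recent coin and each lag
  -- keeps its index as `n` grows.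
  have hY : r * Y σ H N n x = S := by
    rw [Y, hS, Finset.sum_range, ← Equiv.sum_comp Fin.revPerm, Finset.mul_sum]
    refine Finset.sum_congr rfl fun i _ => ?_
    have hi := i.isLt
    rw [dif_pos hi, Fin.revPerm_apply, J_eq hN (by omega) (by rw [Fin.val_rev]; omega), hr',
      Fin.eta, show (Fin.rev i : ℕ) + 1 = n - 1 - i by rw [Fin.val_rev]; omega]
    field_simp
  have hg : r * g σ H N n = σ * presentWeight H n := by
    rw [g_eq hN hn, hr']
    field_simp
  rw [← hY, ← hg, ← mul_add, abs_mul, abs_of_pos hr0, mul_le_mul_iff_right₀ hr0, le_abs]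
  change up σ H N n x ≤ -drift a N n ∨ -drift a N n ≤ down σ H N n x ↔ _
  rw [up, down, or_comm]
  refine or_congr ⟨fun h => ?_, fun h => ?_⟩ ⟨fun h => ?_, fun h => ?_⟩ <;> linarith

/-- The function `a` is bounded on `[0, 1]` by compactness, and `N ^ H / N = N ^ (H - 1)` tends to
`0`. -/
lemma tendsto_rpow_mul_drift {H : ℝ} (hH' : H < 1) {a : ℝ → ℝ}
    (ha : ContinuousOn a (Set.Icc 0 1)) {N : ℕ → ℕ} (hN : ∀ n, n ≤ N n) :
    Tendsto (fun n => (N n : ℝ) ^ H * drift a (N n) n) atTop (𝓝 0) := by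
  obtain ⟨C, hC⟩ := isCompact_Icc.exists_bound_of_continuousOn ha
  have hNt : Tendsto (fun n => (N n : ℝ)) atTop atTop :=
    tendsto_natCast_atTop_atTop.comp (tendsto_atTop_mono hN tendsto_id)
  have h0 := ((tendsto_rpow_neg_atTop (y := 1 - H) (by linarith)).comp hNt).mul_const C
  rw [zero_mul] at h0
  refine squeeze_zero_norm' ?_ h0
  filter_upwards [eventually_ge_atTop 1] with n hn
  have hN0 : (0 : ℝ) < N n := by exact_mod_cast hn.trans (hN n)
  have hmem : (n : ℝ) / N n ∈ Set.Icc (0 : ℝ) 1 :=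
    ⟨by positivity, (div_le_one hN0).2 (by exact_mod_cast hN n)⟩
  have e : (N n : ℝ) ^ H * (1 / N n) = (N n : ℝ) ^ (-(1 - H)) := by
    rw [one_div, ← Real.rpow_neg_one, ← Real.rpow_add hN0]; congr 1; ring
  rw [drift, ← mul_assoc, e, norm_mul, Real.norm_of_nonneg (by positivity)]
  exact mul_le_mul_of_nonneg_left (hC _ hmem) (by positivity)

lemma tendsto_ncard_arbitrageLevel {Ω : Type*} [MeasurableSpace Ω] {P : Measure Ω}
    [IsProbabilityMeasure P] {ξ : ℕ → Ω → ℝ} (hξ : IsCoinSequence P ξ) {σ H : ℝ}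
    (hH : 1 / 2 < H) (hH' : H < 1) (hσ : 0 < σ) {a : ℝ → ℝ} (ha : ContinuousOn a (Set.Icc 0 1))
    {N : ℕ → ℕ} (hN : ∀ n, n ≤ N n) :
    Tendsto (fun n => ((arbitrageLevel σ H a (N n) n).ncard : ℝ) / 2 ^ (n - 1)) atTop
      (𝓝 (P.real {ω | gLim σ H < |limitVar σ H ξ ω|})) := by
  have hc : Tendsto (fun n => ∑ k ∈ Finset.range (n - 1), (σ * pastWeight H n (n - 1 - k) -
      2 * gLim σ H * rho (H / 2 + 1 / 4) (k + 1)) ^ 2) atTop (𝓝 0) := by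
    have h := (tendsto_sum_pastWeight_sub_limitWeight_sq hH hH').const_mul (σ ^ 2)
    rw [mul_zero] at h
    refine h.congr fun n => ?_
    rw [Finset.mul_sum]
    refine Finset.sum_congr rfl fun k _ => ?_
    rw [limitWeight, gLim]
    ring
  have hγ : Tendsto (fun n => σ * presentWeight H n) atTop (𝓝 (gLim σ H)) := by
    have h := (tendsto_presentWeight hH hH').const_mul σ
    rwa [← mul_div_assoc] at h
  have h := (ENNReal.tendsto_toReal (measure_ne_top _ _)).comp
    (hξ.tendsto_measure_le_abs_sum_add (summable_mul_rho_sq (σ := σ) hH hH')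
    (mul_rho_pos hH hH' hσ) (tendsto_sub_atTop_nat 1) hc (tendsto_rpow_mul_drift hH' ha hN) hγ)
  simp_rw [limitVar_eq]
  refine h.congr' ?_
  filter_upwards [eventually_ge_atTop 1] with n hn
  rw [hξ.ncard_div_two_pow, Function.comp_apply, measureReal_def]
  congr 1
  refine measure_congr ?_
  filter_upwards [hξ.ae_eq] with ω hω
  refine propext ?_
  change _ ↔ (fun i : Fin (n - 1) => toSign (ξ (Fin.rev i) ω)) ∈ arbitrageLevel σ H a (N n) n
  rw [mem_arbitrageLevel_iff (hn.trans (hN n)) hn]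
  have e : ∑ k ∈ Finset.range (n - 1), σ * pastWeight H n (n - 1 - k) * ξ k ω =
      ∑ k ∈ Finset.range (n - 1), σ * pastWeight H n (n - 1 - k) * (if hk : k < n - 1 then
        ((toSign (ξ (Fin.rev (Fin.rev (⟨k, hk⟩ : Fin (n - 1)))) ω) : ℤ) : ℝ) else 0) := by
    refine Finset.sum_congr rfl fun k hk => ?_
    rw [dif_pos (Finset.mem_range.1 hk), Fin.rev_rev, coe_toSign (hω k)]
  rw [← e]
  rfl

/-! ### Averaging over the levels of the tree. -/

lemma ncard_arbitragePoints (σ H : ℝ) (a : ℝ → ℝ) (N : ℕ) :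
    (arbitragePoints σ H a N).ncard =
      ∑ i ∈ Finset.range N, (arbitrageLevel σ H a N (i + 1)).ncard := by
  classical
  have e : arbitragePoints σ H a N =
      ↑((Finset.univ : Finset (Finset.Icc 1 N)).sigma
        fun n => (arbitrageLevel σ H a N (n : ℕ)).toFinset) := by
    ext ⟨n, x⟩
    simp only [arbitragePoints, Set.mem_iUnion, Finset.coe_sigma, Set.mem_sigma_iff,
      Finset.coe_univ, Set.mem_univ, true_and, Set.coe_toFinset]
    constructor
    · rintro ⟨i, y, hy, h⟩
      cases h
      exact hy
    · exact fun h => ⟨n, x, h, rfl⟩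
  rw [e, Set.ncard_coe_finset, Finset.card_sigma]
  simp_rw [← Set.ncard_eq_toFinset_card']
  rw [Finset.sum_coe_sort (Finset.Icc 1 N) fun n => (arbitrageLevel σ H a N n).ncard,
    show Finset.Icc 1 N = Finset.Ico 1 (N + 1) by ext; simp, Finset.sum_Ico_eq_sum_range]
  exact Finset.sum_congr rfl fun i _ => by rw [add_comm]

/-- The weights `2 ^ i` add up to `2 ^ N - 1`: the levels below a fixed `m` contribute a bounded
amount, negligible after division, and the others are uniformly close to `L`. -/
lemma tendsto_sum_two_pow_mul_div {p : ℕ → ℕ → ℝ} {L C : ℝ} (hC : ∀ N i, |p N i - L| ≤ C)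
    (hp : ∀ ε > 0, ∃ m, ∀ i ≥ m, ∀ N > i, |p N i - L| < ε) :
    Tendsto (fun N : ℕ => (∑ i ∈ Finset.range N, 2 ^ i * p N i) / (2 ^ N - 1)) atTop (𝓝 L) := by
  have hgeom : ∀ N, ∑ i ∈ Finset.range N, (2 : ℝ) ^ i = 2 ^ N - 1 := fun N => by
    rw [geom_sum_eq (by norm_num)]; norm_num
  have hC0 : 0 ≤ C := (abs_nonneg _).trans (hC 0 0)
  rw [Metric.tendsto_atTop]
  intro ε hε
  obtain ⟨m, hm⟩ := hp (ε / 2) (by linarith)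
  have hT : Tendsto (fun N : ℕ => (2 : ℝ) ^ N) atTop atTop :=
    tendsto_pow_atTop_atTop_of_one_lt one_lt_two
  obtain ⟨N₀, hN₀⟩ := eventually_atTop.1
    (hT.eventually_gt_atTop (1 + C * (2 ^ m - 1) / (ε / 2)))
  have h2 : ∀ k : ℕ, (1 : ℝ) ≤ 2 ^ k := fun k => one_le_pow₀ one_le_two
  refine ⟨max N₀ m, fun N hN => ?_⟩
  have hNm : m ≤ N := (le_max_right _ _).trans hN
  have hbig := hN₀ N ((le_max_left _ _).trans hN)
  have hpos : (0 : ℝ) < 2 ^ N - 1 := by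
    have : 0 ≤ C * (2 ^ m - 1) / (ε / 2) :=
      div_nonneg (mul_nonneg hC0 (by linarith [h2 m])) (by linarith)
    linarith
  rw [Real.dist_eq, div_sub' hpos.ne', abs_div, abs_of_pos hpos, div_lt_iff₀ hpos, ← hgeom,
    Finset.sum_mul, ← Finset.sum_sub_distrib, hgeom]
  have h1 : |∑ i ∈ Finset.range N, ((2 : ℝ) ^ i * p N i - 2 ^ i * L)| ≤
      ∑ i ∈ Finset.range N, (2 : ℝ) ^ i * |p N i - L| := by
    refine (Finset.abs_sum_le_sum_abs _ _).trans (le_of_eq (Finset.sum_congr rfl fun i _ => ?_))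
    rw [← mul_sub, abs_mul, abs_of_pos (by positivity)]
  have h3 : ∑ i ∈ Finset.range m, (2 : ℝ) ^ i * |p N i - L| ≤ C * (2 ^ m - 1) := by
    rw [← hgeom, Finset.mul_sum]
    refine Finset.sum_le_sum fun i _ => ?_
    rw [mul_comm]
    exact mul_le_mul_of_nonneg_right (hC N i) (by positivity)
  have h4 : ∑ i ∈ Finset.Ico m N, (2 : ℝ) ^ i * |p N i - L| ≤ ε / 2 * (2 ^ N - 1) := by
    calc _ ≤ ∑ i ∈ Finset.Ico m N, (2 : ℝ) ^ i * (ε / 2) := Finset.sum_le_sum fun i hi =>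
          mul_le_mul_of_nonneg_left (hm i (Finset.mem_Ico.1 hi).1 N (Finset.mem_Ico.1 hi).2).le
            (by positivity)
      _ ≤ ∑ i ∈ Finset.range N, (2 : ℝ) ^ i * (ε / 2) :=
          Finset.sum_le_sum_of_subset_of_nonneg
            (fun i hi => Finset.mem_range.2 (Finset.mem_Ico.1 hi).2) fun i _ _ => by positivity
      _ = _ := by rw [← Finset.sum_mul, hgeom, mul_comm]
  have h5 : C * (2 ^ m - 1) < ε / 2 * (2 ^ N - 1) := by
    have : C * (2 ^ m - 1) / (ε / 2) < 2 ^ N - 1 := by linarith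
    rwa [div_lt_iff₀' (by linarith)] at this
  have h6 := Finset.sum_range_add_sum_Ico (fun i => (2 : ℝ) ^ i * |p N i - L|) hNm
  linarith

lemma tendsto_ncard_arbitragePoints {σ H L : ℝ} {a : ℝ → ℝ} (hL : 0 ≤ L) (hL' : L ≤ 1)
    (h : ∀ N : ℕ → ℕ, (∀ n, n ≤ N n) → Tendsto
      (fun n => ((arbitrageLevel σ H a (N n) n).ncard : ℝ) / 2 ^ (n - 1)) atTop (𝓝 L)) :
    Tendsto (fun N : ℕ => ((arbitragePoints σ H a N).ncard : ℝ) / (2 ^ N - 1)) atTop (𝓝 L) := by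
  classical
  have key := tendsto_sum_two_pow_mul_div (L := L) (C := 1)
    (p := fun N i => ((arbitrageLevel σ H a N (i + 1)).ncard : ℝ) / 2 ^ i) (fun N i => ?_)
    fun ε hε => ?_
  · refine key.congr fun N => ?_
    rw [ncard_arbitragePoints, Nat.cast_sum]
    congr 1
    exact Finset.sum_congr rfl fun i _ => mul_div_cancel₀ _ (by positivity)
  · have h0 : (0 : ℝ) ≤ ((arbitrageLevel σ H a N (i + 1)).ncard : ℝ) / 2 ^ i := by positivity
    have h1 : ((arbitrageLevel σ H a N (i + 1)).ncard : ℝ) / 2 ^ i ≤ 1 := by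
      rw [div_le_one (by positivity)]
      have := Set.ncard_le_card (arbitrageLevel σ H a N (i + 1))
      simp only [Nat.card_eq_fintype_card, Fintype.card_fun, Fintype.card_units_int,
        Fintype.card_fin, Nat.add_sub_cancel] at this
      exact_mod_cast this
    exact abs_sub_le_iff.2 ⟨by linarith, by linarith⟩
  -- Uniformity in the horizon by contradiction: for each `n` a horizon violating the `ε` bound is
  -- chosen if there is one, and `n` otherwise, which keeps `n ≤ N n`. Convergence along this one
  -- sequence excludes violations at all large levels.
  · let N : ℕ → ℕ := fun n =>
      if hn : ∃ N, n ≤ N ∧ ε ≤ |((arbitrageLevel σ H a N n).ncard : ℝ) / 2 ^ (n - 1) - L| then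
        hn.choose else n
    have hN : ∀ n, n ≤ N n := by
      intro n
      by_cases hn : ∃ N, n ≤ N ∧ ε ≤ |((arbitrageLevel σ H a N n).ncard : ℝ) / 2 ^ (n - 1) - L|
      · simp only [N, dif_pos hn]
        exact hn.choose_spec.1
      · simp only [N, dif_neg hn]
        exact le_rfl
    obtain ⟨m, hm⟩ := Metric.tendsto_atTop.1 (h N hN) ε hε
    refine ⟨m, fun i hi M hM => ?_⟩
    by_contra hcon
    have hn : ∃ N, i + 1 ≤ N ∧
        ε ≤ |((arbitrageLevel σ H a N (i + 1)).ncard : ℝ) / 2 ^ (i + 1 - 1) - L| :=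
      ⟨M, hM, not_lt.1 hcon⟩
    have h1 := hm (i + 1) (by omega)
    simp only [N, dif_pos hn, Real.dist_eq] at h1
    exact absurd h1 (not_lt.2 hn.choose_spec.2)

end

end FractionalBinary

theorem theorem3p2 {Ω : Type*} [MeasurableSpace Ω] (P : Measure Ω) [IsProbabilityMeasure P]
    (H σ : ℝ) (hH : 1 / 2 < H) (hH' : H < 1) (hσ : 0 < σ)
    (a : ℝ → ℝ) (ha : ContinuousOn a (Set.Icc 0 1))
    (ξ : ℕ → Ω → ℝ) (hmeas : ∀ k, Measurable (ξ k)) (hindep : iIndepFun ξ P)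
    (hup : ∀ k, P {ω | ξ k ω = 1} = 1 / 2) (hdown : ∀ k, P {ω | ξ k ω = -1} = 1 / 2) :
    -- the series defining `𝒴_H` converges almost surely to `𝒴_H`
    (∀ᵐ ω ∂P, Tendsto (fun m => FractionalBinary.limitPartialSum σ H ξ m ω) atTop
      (𝓝 (FractionalBinary.limitVar σ H ξ ω))) ∧
    -- the proportion of arbitrage points at level `n`
    (∀ N : ℕ → ℕ, (∀ n, n ≤ N n) →
      Tendsto
        (fun n => ((FractionalBinary.arbitrageLevel σ H a (N n) n).ncard : ℝ) / 2 ^ (n - 1))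
        atTop
        (𝓝 (P.real {ω | FractionalBinary.gLim σ H < |FractionalBinary.limitVar σ H ξ ω|}))) ∧
    -- positivity of the limit
    0 < P.real {ω | FractionalBinary.gLim σ H < |FractionalBinary.limitVar σ H ξ ω|} ∧
    -- the overall proportion of arbitrage points
    Tendsto
      (fun N : ℕ => ((FractionalBinary.arbitragePoints σ H a N).ncard : ℝ) / (2 ^ N - 1))
      atTop
      (𝓝 (P.real {ω | FractionalBinary.gLim σ H < |FractionalBinary.limitVar σ H ξ ω|})) := by
  have hξ : FractionalBinary.IsCoinSequence P ξ := ⟨hmeas, hindep, hup, hdown⟩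
  have hb := FractionalBinary.summable_mul_rho_sq (σ := σ) hH hH'
  have hlevel := fun (N : ℕ → ℕ) (hN : ∀ n, n ≤ N n) =>
    FractionalBinary.tendsto_ncard_arbitrageLevel hξ hH hH' hσ ha hN
  refine ⟨?_, hlevel, ?_, FractionalBinary.tendsto_ncard_arbitragePoints measureReal_nonneg
    measureReal_le_one hlevel⟩
  · simp_rw [FractionalBinary.limitPartialSum_eq, FractionalBinary.limitVar_eq]
    exact hξ.ae_tendsto_seriesValue hb
  · have hg := FractionalBinary.gLim_pos hH hH' hσ
    -- Here `h = H / 2 + 1 / 4 > 1 / 2`, the long-memory range in which the autocovariances are not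
    -- summable.
    have hdiv : Tendsto (fun m => ∑ k ∈ Finset.range m, 2 * FractionalBinary.gLim σ H *
        FractionalBinary.rho (H / 2 + 1 / 4) (k + 1)) atTop atTop := by
      simp_rw [← Finset.mul_sum]
      exact (FractionalBinary.tendsto_sum_rho (by linarith)).const_mul_atTop (by linarith)
    have h := hξ.measure_lt_series_pos hb hdiv (FractionalBinary.gLim σ H)
    simp_rw [FractionalBinary.limitVar_eq]
    refine ENNReal.toReal_pos (h.trans_le (measure_mono fun ω hω => ?_)).ne' (measure_ne_top _ _)
    rw [Set.mem_ofPred_eq] at hω ⊢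
    exact hω.trans_le (le_abs_self _)
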